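/- \textbf{Theorem (The pcf Theorem).} Let $A$ be a set of (infinite) regular cardinals with no maximum and let $I$ be an ideal on $A$. For a cardinal $\theta$, $I$ is \emph{weakly $\theta$-saturated} if there is no partition of $A$ into $\theta$ many sets not in $I$; $\mathrm{wsat}(I)$ is the least such $\theta$. For a regular cardinal $\theta$, $I$ is \emph{$\theta$-indecomposable} if it is closed under unions of $\subseteq$-increasing sequences of length $\theta$, and \emph{$\theta$-regular} if it is both weakly $\theta$-saturated and $\theta$-indecomposable; $\mathrm{reg}(I)$ is the least regular $\theta$ such that $I$ is $\theta$-regular. $A$ is \emph{progressive over $I$} if $\mathrm{wsat}(I)<\min A$ and $\mathrm{reg}(I)<\min A$. Let $\prod A$ be the set of functions $f$ on $A$ with $f(a)<a$ for every $a\in A$ (cardinals being viewed as initial ordinals). For an ultrafilter $D$ over $A$, let $\prod A/D$ be the set of classes of members of $\prod A$ modulo $D$, linearly ordered by $[f]\le[g]\iff\{a\in A: f(a)\le g(a)\}\in D$. Put $$\mathrm{pcf}_I(A)=\{\mathrm{cf}(\textstyle\prod A/D) : D\text{ an ultrafilter over }A\text{ disjoint from }I\},$$ and for a cardinal $\lambda$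 let $J^I_{<\lambda}[A]$ be the ideal of all $B\subseteq A$ such that $B\in I$, or $\mathrm{cf}(\prod A/D)<\lambda$ for every ultrafilter $D$ over $A$ disjoint from $I$ with $B\in D$. Suppose that $A$ is progressive over $I$. Then for every $\lambda\in\mathrm{pcf}_I(A)$ there is a set $B_\lambda\subseteq A$ such that $$J^I_{<\lambda^+}[A]=J^I_{<\lambda}[A]+B_\lambda,$$ that is, $J^I_{<\lambda^+}[A]$ is the ideal on $A$ generated by $J^I_{<\lambda}[A]\cup\{B_\lambda\}$. -/

import Mathlib

universe u

noncomputable section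

namespace Pcf

open Cardinal

variable {X : Type u}

/-! ### Ideals of sets: weak saturation, indecomposability, regularity -/

/-- `I` is weakly `θ`-saturated: there is no partition of the underlying set
into `θ` many `I`-positive sets. -/
def WeaklySaturated (I : Order.Ideal (Set X)) (θ : Cardinal.{u}) : Prop :=
  ¬ ∃ P : Set (Set X), #P = θ ∧ Setoid.IsPartition P ∧ ∀ B ∈ P, B ∉ I

/-- A partition of `X` has at most `#X` pieces. -/
theorem mk_partition_le (P : Set (Set X)) (hP : Setoid.IsPartition P) : #P ≤ #X := by
  have hne : ∀ B : P, ∃ x, x ∈ (B : Set X) := fun B =>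
    Setoid.nonempty_of_mem_partition hP B.2
  choose f hf using hne
  refine mk_le_of_injective (f := f) fun B C h => Subtype.ext ?_
  exact (hP.2 (f B)).unique ⟨B.2, hf B⟩ ⟨C.2, h ▸ hf C⟩

/-- `wsat I` is the least cardinal `θ` such that `I` is weakly `θ`-saturated. -/
def wsat (I : Order.Ideal (Set X)) : Cardinal.{u} :=
  sInf {θ | WeaklySaturated I θ}

/-- `I` is `θ`-indecomposable: it is closed under unions of `⊆`-increasing
sequences of length `θ`. -/
def Indecomposable (I : Order.Ideal (Set X)) (θ : Cardinal.{u}) : Prop :=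
  ∀ B : θ.ord.ToType → Set X, Monotone B → (∀ i, B i ∈ I) → (⋃ i, B i) ∈ I

/-- For a regular cardinal `θ`, `I` is `θ`-regular: it is weakly `θ`-saturated and
`θ`-indecomposable. -/
def RegularAt (I : Order.Ideal (Set X)) (θ : Cardinal.{u}) : Prop :=
  θ.IsRegular ∧ WeaklySaturated I θ ∧ Indecomposable I θ

/-- `reg I` is the least regular cardinal `θ` such that `I` is `θ`-regular. -/
def reg (I : Order.Ideal (Set X)) : Cardinal.{u} :=
  sInf {θ | RegularAt I θ}

/-- `wsat I` is a genuine minimum. -/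
theorem weaklySaturated_wsat (I : Order.Ideal (Set X)) : WeaklySaturated I (wsat I) := by
  refine csInf_mem (s := {θ | WeaklySaturated I θ}) ⟨Order.succ #X, ?_⟩
  rintro ⟨P, hP, hpart, -⟩
  exact absurd (mk_partition_le P hpart) (not_le.2 (hP ▸ Order.lt_succ #X))

/-- `reg I` is a genuine minimum. -/
theorem regularAt_reg (I : Order.Ideal (Set X)) : RegularAt I (reg I) := by
  refine csInf_mem (s := {θ | RegularAt I θ}) ⟨Order.succ (max ℵ₀ #X), ?_⟩
  have hlt : #X < Order.succ (max ℵ₀ #X) := Order.lt_succ_of_le (le_max_right _ _)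
  have hreg : (Order.succ (max ℵ₀ #X)).IsRegular := isRegular_succ (le_max_left _ _)
  refine ⟨hreg, ?_, ?_⟩
  · rintro ⟨P, hP, hpart, -⟩
    exact absurd (mk_partition_le P hpart) (not_le.2 (hP ▸ hlt))
  · intro B hB hI
    have hex : ∀ x : (⋃ i, B i : Set X), ∃ i, (x : X) ∈ B i := fun x => Set.mem_iUnion.1 x.2
    choose i hi using hex
    have hnc : ¬ IsCofinal (Set.range i) := by
      intro hc
      have h1 := (Order.cof_le hc).trans (mk_range_le.trans (mk_set_le _))
      rw [Ordinal.cof_toType, hreg.cof_ord] at h1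
      exact absurd h1 (not_le.2 hlt)
    have : ∃ j, ∀ x, i x ≤ j := by
      simp only [IsCofinal, not_forall, not_exists, not_and, Set.forall_mem_range, not_le] at hnc
      obtain ⟨j, hj⟩ := hnc
      exact ⟨j, fun x => (hj x).le⟩
    obtain ⟨j, hj⟩ := this
    exact I.lower (fun x hx => hB (hj ⟨x, hx⟩) (hi ⟨x, hx⟩)) (hI j)

/-! ### Products of cardinals modulo ultrafilters, and `pcf` -/

/-- `∏ A`: the functions `f` on `A` with `f(a) < a` for all `a ∈ A`, where cardinals
are viewed as initial ordinals. -/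
def prod (A : Set Cardinal.{u}) : Set (A → Ordinal.{u}) :=
  {f | ∀ a : A, f a < (a : Cardinal.{u}).ord}

/-- `∏ A / D`: the classes modulo `D` of the members of `∏ A`. It inherits the (linear)
order of the germs: `[f] ≤ [g]` iff `{a | f a ≤ g a} ∈ D`. -/
def ultraprod (A : Set Cardinal.{u}) (D : Ultrafilter A) :
    Set (Filter.Germ (D : Filter A) Ordinal.{u}) :=
  (fun f : A → Ordinal.{u} => (f : Filter.Germ (D : Filter A) Ordinal.{u})) '' prod A

/-- The cofinality of `∏ A / D`. -/
def ultracof (A : Set Cardinal.{u}) (D : Ultrafilter A) : Cardinal.{u + 1} :=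
  Order.cof (ultraprod A D)

/-- The ultrafilter `D` is disjoint from the ideal `I`. -/
def DisjointFrom (D : Ultrafilter X) (I : Order.Ideal (Set X)) : Prop :=
  ∀ B ∈ I, B ∉ D

/-- `pcf_I(A)`: the cofinalities of `∏ A / D`, for ultrafilters `D` over `A` disjoint
from `I`. -/
def pcf (A : Set Cardinal.{u}) (I : Order.Ideal (Set A)) : Set Cardinal.{u + 1} :=
  {κ | ∃ D : Ultrafilter A, DisjointFrom D I ∧ ultracof A D = κ}

/-- The ideal `J^I_{<κ}[A]`. -/
def J (A : Set Cardinal.{u}) (I : Order.Ideal (Set A)) (κ : Cardinal.{u + 1}) :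
    Order.Ideal (Set A) where
  carrier := {B | B ∈ I ∨ ∀ D : Ultrafilter A, DisjointFrom D I → B ∈ D → ultracof A D < κ}
  lower' := by
    rintro B C hCB (hB | hB)
    · exact Or.inl (I.lower hCB hB)
    · exact Or.inr fun D hD hC => hB D hD (Filter.mem_of_superset hC hCB)
  nonempty' := ⟨∅, Or.inl I.bot_mem⟩
  directed' := by
    have key : ∀ B : Set A, (B ∈ I ∨ ∀ D : Ultrafilter A, DisjointFrom D I → B ∈ D →
        ultracof A D < κ) → ∀ D : Ultrafilter A, DisjointFrom D I → B ∈ D →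
        ultracof A D < κ := by
      rintro B (hB | hB) D hD hBD
      · exact absurd hBD (hD B hB)
      · exact hB D hD hBD
    intro B hB C hC
    refine ⟨B ∪ C, Or.inr fun D hD h => ?_, Set.subset_union_left, Set.subset_union_right⟩
    rcases Ultrafilter.union_mem_iff.1 h with h | h
    · exact key B hB D hD h
    · exact key C hC D hD h

/-- `A` is progressive over `I`: `wsat(I) < min A` and `reg(I) < min A`. The universe lift
only regards `a` as a cardinal of the universe in which the set `A` lives. -/
def Progressive (A : Set Cardinal.{u}) (I : Order.Ideal (Set A)) : Prop :=
  (∀ a ∈ A, wsat I < Cardinal.lift.{u + 1} a) ∧ ∀ a ∈ A, reg I < Cardinal.lift.{u + 1} a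

/-- `B` is a generator for `κ`: the ideal `J^I_{<κ⁺}[A]` is generated by
`J^I_{<κ}[A] ∪ {B}`, that is, it is the least ideal containing this collection. -/
def IsGenerator (A : Set Cardinal.{u}) (I : Order.Ideal (Set A)) (κ : Cardinal.{u + 1})
    (B : Set A) : Prop :=
  IsLeast {K : Order.Ideal (Set A) | J A I κ ≤ K ∧ B ∈ K} (J A I (Order.succ κ))

end Pcf

end

/-!
Let `θ = reg I`. This is a regular cardinal below all the members of `A`, and `I` is weakly
`θ`-saturated. The latter enters in one way only: an increasing or decreasing chain of sets of
length `θ` is constant modulo `I` from some stage on (`WeaklySaturated.exists_stable`). Since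
`θ` many functions in `∏ A` have a pointwise bound in `∏ A`, constructions of functions can be
continued for `θ` many steps, and such a chain then yields a contradiction. This replaces the
assumption `|A| < min A` of the classical theory. In this way one obtains

* thresholds for sequences that increase modulo `J A I κ` (`exists_threshold`), and from them the
  `κ`-directedness of `∏ A` modulo `J A I κ` (`exists_bound_mod_J`), so that an ultrafilter disjoint
  from `J A I κ` has cofinality at least `κ` (`le_ultracof`);
* a sequence `f` of length `κ`, increasing modulo `J A I κ` and cofinal modulo every ultrafilter
  of cofinality `κ` (`exists_universal`).

With a threshold `h` for `f`, the sets `B i = {a | h a < f i a}` lie in `J A I κ⁺`, increase modulo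
`J A I κ` and absorb every member of `J A I κ⁺` (`Universal.exists_sdiff_mem_J`). So some `B i` is a
generator as soon as they stop growing modulo `J A I κ`.

To see that they do, let `τ = θ⁺⁺`. If `κ ≤ τ`, only finitely many members of `A` are at most `κ`,
and they form a generator. If `τ < κ`, the members of `A` that are at most `τ` form a set in
`J A I κ`, so `f` can be arranged to bound, at suitable points `δ` of cofinality `τ`, the functions
along a closed unbounded subset of `δ` (`exists_continuous_universal`). Guessing closed unbounded
subsets of `τ` by sequences of length `θ` (`exists_clubGuessing`) then produces `θ` many indices
along which `f` increases so strongly that endless growth of the sets `B i` would contradict weak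
`θ`-saturation (`exists_isGenerator_of_lt`).
-/

universe v w

namespace Pcf

open Cardinal

/-! ### Ordinal recursion and suprema -/

/-- Transfinite recursion along a relation: if every history below `ε` admits an admissible next
value, then there is a sequence all of whose values are admissible. Admissibility at `ε` may only
depend on the part of the history below `ε`. -/
theorem exists_seq {S : Type w} [Nonempty S] (R : Ordinal.{v} → (Ordinal.{v} → S) → S → Prop)
    (hloc : ∀ ε g g' b, (∀ ζ < ε, g ζ = g' ζ) → R ε g b → R ε g' b)
    (hR : ∀ ε g, ∃ b, R ε g b) : ∃ g : Ordinal.{v} → S, ∀ ε, R ε g (g ε) := by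
  classical
  choose N hN using hR
  let s₀ : S := Classical.arbitrary S
  let F : ∀ ε : Ordinal.{v}, (∀ ζ, ζ < ε → S) → S := fun ε ih =>
    N ε fun ζ => if h : ζ < ε then ih ζ h else s₀
  let g : Ordinal.{v} → S := (wellFounded_lt (α := Ordinal.{v})).fix F
  have hg : ∀ ε, g ε = N ε fun ζ => if ζ < ε then g ζ else s₀ := by
    intro ε
    have := (wellFounded_lt (α := Ordinal.{v})).fix_eq F ε
    simpa only [F, dite_eq_ite] using this
  refine ⟨g, fun ε => ?_⟩
  rw [hg]
  exact hloc ε _ _ _ (fun ζ hζ => if_pos hζ) (hN ε _)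

/-- The supremum of the values of `p` at the ordinals below `i`. As a function of `i` it is
monotone and continuous, whatever `p` is. -/
noncomputable def supBelow (p : Ordinal.{v} → Ordinal.{v}) (i : Ordinal.{v}) : Ordinal.{v} :=
  ⨆ j : Set.Iio i, p j

theorem le_supBelow (p : Ordinal.{v} → Ordinal.{v}) {i j : Ordinal.{v}} (h : j < i) :
    p j ≤ supBelow p i :=
  Ordinal.le_iSup (fun j : Set.Iio i => p j) ⟨j, h⟩

theorem supBelow_le {p : Ordinal.{v} → Ordinal.{v}} {i b : Ordinal.{v}} (h : ∀ j < i, p j ≤ b) :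
    supBelow p i ≤ b :=
  Ordinal.iSup_le fun j => h j j.2

theorem lt_supBelow_iff {p : Ordinal.{v} → Ordinal.{v}} {i b : Ordinal.{v}} :
    b < supBelow p i ↔ ∃ j < i, b < p j := by
  rw [← not_iff_not]
  push Not
  exact ⟨fun h j hj => (le_supBelow p hj).trans h, supBelow_le⟩

theorem supBelow_mono (p : Ordinal.{v} → Ordinal.{v}) : Monotone (supBelow p) :=
  fun _ _ h => supBelow_le fun _ hj => le_supBelow p (hj.trans_le h)

theorem supBelow_congr {p q : Ordinal.{v} → Ordinal.{v}} {i : Ordinal.{v}}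
    (h : ∀ j < i, p j = q j) : supBelow p i = supBelow q i :=
  le_antisymm (supBelow_le fun j hj => h j hj ▸ le_supBelow q hj)
    (supBelow_le fun j hj => h j hj ▸ le_supBelow p hj)

/-- Fewer than `cof o` ordinals below `o` are bounded below `o`, even when the index ordinal and
`o` live in different universes. -/
theorem exists_lt_forall_le_lift {f : Ordinal.{v} → Ordinal.{w}} {c : Ordinal.{v}}
    {o : Ordinal.{w}} (hc : lift.{w} c.card < lift.{v} o.cof) (h : ∀ i < c, f i < o) :
    ∃ b < o, ∀ i < c, f i ≤ b := by
  refine ⟨⨆ i : Set.Iio c, f i, ?_, fun i hi => ?_⟩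
  · refine Ordinal.lift_iSup_lt_of_lt_cof ?_ fun i => h i i.2
    rw [← Ordinal.lift_cof, Cardinal.mk_Iio_ordinal, ← Cardinal.lift_lt.{_, 0}]
    simpa [Cardinal.lift_lift, Cardinal.lift_umax] using Cardinal.lift_lt.{_, v + 1}.2 hc
  · exact le_ciSup (f := fun i : Set.Iio c => f i) ⟨o, by rintro _ ⟨j, rfl⟩; exact (h j j.2).le⟩
      ⟨i, hi⟩

theorem exists_lt_forall_le {f : Ordinal.{v} → Ordinal.{v}} {c o : Ordinal.{v}}
    (hc : c.card < o.cof) (h : ∀ i < c, f i < o) : ∃ b < o, ∀ i < c, f i ≤ b :=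
  exists_lt_forall_le_lift (by simpa using hc) h

theorem supBelow_lt {p : Ordinal.{v} → Ordinal.{v}} {c o : Ordinal.{v}}
    (hc : c.card < o.cof) (h : ∀ i < c, p i < o) : supBelow p c < o := by
  obtain ⟨b, hb, hpb⟩ := exists_lt_forall_le hc h
  exact (supBelow_le hpb).trans_lt hb

/-- A nonzero ordinal of cofinality at most `c` is the supremum of `c` ordinals below it. -/
theorem exists_cofinal_seq {o : Ordinal.{v}} {c : Cardinal.{v}} (ho : 0 < o) (hc : o.cof ≤ c) :
    ∃ p : Ordinal.{v} → Ordinal.{v}, (∀ j, p j < o) ∧ ∀ i < o, ∃ j < c.ord, i ≤ p j := by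
  obtain ⟨f, hf⟩ := Ordinal.exists_isFundamentalSeq (o := o) rfl
  refine ⟨fun j => if h : j ∈ Set.Iio o.cof.ord then f ⟨j, h⟩ else 0, fun j => ?_, fun i hi => ?_⟩
  · dsimp only
    split_ifs with h
    · exact (f ⟨j, h⟩).2
    · exact ho
  · obtain ⟨_, ⟨j, rfl⟩, hj⟩ := hf.isCofinal_range ⟨i, hi⟩
    refine ⟨j, j.2.trans_le (ord_le_ord.2 hc), ?_⟩
    simpa only [Subtype.coe_prop, dite_true] using Subtype.coe_le_coe.2 hj

/-! ### Closed unbounded sets and club guessing -/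

/-- `C` is a closed unbounded subset of the ordinal `o`. Closure under suprema includes the
supremum of the empty set, so that such a set contains `0`. -/
structure IsClubBelow (o : Ordinal.{v}) (C : Set Ordinal.{v}) : Prop where
  lt : ∀ i ∈ C, i < o
  sSup_mem : ∀ s ⊆ C, sSup s < o → sSup s ∈ C
  exists_gt : ∀ i < o, ∃ j ∈ C, i < j

/-- Below an uncountable regular cardinal, a relation that can be continued everywhere can be
iterated `ω` times while staying bounded. -/
theorem exists_nat_seq {τ : Cardinal.{v}} (hτ : τ.IsRegular) (hτ' : ℵ₀ < τ)
    (R : Ordinal.{v} → Ordinal.{v} → Prop)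
    (hR : ∀ i < τ.ord, ∃ j < τ.ord, i < j ∧ R i j) {i₀ : Ordinal.{v}} (hi₀ : i₀ < τ.ord) :
    ∃ x : ℕ → Ordinal.{v}, x 0 = i₀ ∧ (∀ n, x n < x (n + 1) ∧ R (x n) (x (n + 1))) ∧
      ⨆ n, x n < τ.ord := by
  choose! N hN using hR
  have hlt : ∀ n, N^[n] i₀ < τ.ord := by
    intro n
    induction n with
    | zero => exact hi₀
    | succ n ih => rw [Function.iterate_succ_apply']; exact (hN _ ih).1
  refine ⟨fun n => N^[n] i₀, rfl, fun n => ?_, ?_⟩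
  · dsimp only
    rw [Function.iterate_succ_apply']
    exact (hN _ (hlt n)).2
  · refine Ordinal.lift_iSup_lt_of_lt_cof ?_ hlt
    simpa [hτ.cof_ord] using hτ'

/-- The intersection of fewer than `τ` closed unbounded subsets of an uncountable regular
cardinal `τ`. -/
theorem IsClubBelow.biInter {τ : Cardinal.{v}} (hτ : τ.IsRegular) (hτ' : ℵ₀ < τ)
    {c : Ordinal.{v}} (hc : c.card < τ) (hc0 : 0 < c) {E : Ordinal.{v} → Set Ordinal.{v}}
    (hE : ∀ ε < c, IsClubBelow τ.ord (E ε)) : IsClubBelow τ.ord {i | ∀ ε < c, i ∈ E ε} := by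
  refine ⟨fun i hi => (hE 0 hc0).lt i (hi 0 hc0), fun s hs hlt ε hε =>
    (hE ε hε).sSup_mem s (fun i hi => hs hi ε hε) hlt, fun i₀ hi₀ => ?_⟩
  have hex : ∀ i < τ.ord, ∀ ε < c, ∃ j ∈ E ε, i < j := fun i hi ε hε => (hE ε hε).exists_gt i hi
  obtain ⟨x, hx0, hx, hlt⟩ := exists_nat_seq hτ hτ' (fun i j => ∀ ε < c, ∃ k ∈ E ε, i < k ∧ k ≤ j)
    (by
      intro i hi
      choose! k hk using hex i hi
      obtain ⟨b, hb, hkb⟩ := exists_lt_forall_le (f := k) (c := c) (o := τ.ord)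
        (by rwa [hτ.cof_ord]) fun ε hε => (hE ε hε).lt _ (hk ε hε).1
      exact ⟨b, hb, (hk 0 hc0).2.trans_le (hkb 0 hc0),
        fun ε hε => ⟨k ε, (hk ε hε).1, (hk ε hε).2, hkb ε hε⟩⟩) hi₀
  have hle : ∀ n, x n ≤ ⨆ n, x n := fun n => Ordinal.le_iSup x n
  refine ⟨⨆ n, x n, fun ε hε => ?_, by rw [← hx0]; exact (hx 0).1.trans_le (hle 1)⟩
  choose k hk using fun n => (hx n).2 ε hε
  have hsup : sSup (Set.range k) = ⨆ n, x n := by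
    refine le_antisymm ?_ ?_
    · exact Ordinal.iSup_le fun n => (hk n).2.2.trans (hle (n + 1))
    · exact Ordinal.iSup_le fun n => (hk n).2.1.le.trans (Ordinal.le_iSup k n)
  rw [← hsup]
  refine (hE ε hε).sSup_mem _ ?_ (hsup ▸ hlt)
  rintro _ ⟨n, rfl⟩
  exact (hk n).1

theorem IsClubBelow.inter {τ : Cardinal.{v}} (hτ : τ.IsRegular) (hτ' : ℵ₀ < τ)
    {C D : Set Ordinal.{v}} (hC : IsClubBelow τ.ord C) (hD : IsClubBelow τ.ord D) :
    IsClubBelow τ.ord (C ∩ D) := by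
  have := IsClubBelow.biInter hτ hτ' (c := 2) (E := fun ε => if ε = 0 then C else D)
    (by simpa using hτ.nat_lt 2) (by simp) (fun ε _ => by split_ifs <;> assumption)
  have heq : {i | ∀ ε < (2 : Ordinal.{v}), i ∈ if ε = 0 then C else D} = C ∩ D := by
    ext i
    refine ⟨fun h => ⟨by simpa using h 0 (by simp), by simpa using h 1 (by norm_num)⟩,
      fun h ε _ => ?_⟩
    split_ifs
    exacts [h.1, h.2]
  rwa [heq] at this

/-- `p` climbs up to `c`: below `c`, each value exceeds the supremum of all the earlier ones.
Then `supBelow p` is strictly increasing and continuous up to `c`. -/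
def Climbs (p : Ordinal.{v} → Ordinal.{v}) (c : Ordinal.{v}) : Prop :=
  ∀ j < c, supBelow p j < p j

theorem Climbs.strictMono {p : Ordinal.{v} → Ordinal.{v}} {c i j : Ordinal.{v}} (hp : Climbs p c)
    (hj : j ≤ c) (hij : i < j) : supBelow p i < supBelow p j :=
  (hp i (hij.trans_le hj)).trans_le (le_supBelow p hij)

theorem Climbs.lt_supBelow {p : Ordinal.{v} → Ordinal.{v}} {c j : Ordinal.{v}} (hp : Climbs p c)
    (hc : Order.IsSuccLimit c) (hj : j < c) : p j < supBelow p c :=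
  (le_supBelow p (Order.lt_succ j)).trans_lt (hp.strictMono le_rfl (hc.succ_lt hj))

/-- The points below `τ` where two continuous sequences with the same supremum agree form a
closed unbounded set. -/
theorem Climbs.isClubBelow_eq {τ : Cardinal.{v}} (hτ : τ.IsRegular) (hτ' : ℵ₀ < τ)
    {p q : Ordinal.{v} → Ordinal.{v}} (hp : Climbs p τ.ord) (hq : Climbs q τ.ord)
    (h : supBelow p τ.ord = supBelow q τ.ord) :
    IsClubBelow τ.ord {i | i < τ.ord ∧ supBelow p i = supBelow q i} := by
  have hsucc : ∀ i < τ.ord, i + 1 < τ.ord := fun i hi =>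
    (isSuccLimit_ord hτ.aleph0_le).succ_lt hi
  have key : ∀ {p q : Ordinal.{v} → Ordinal.{v}}, Climbs p τ.ord →
      supBelow p τ.ord = supBelow q τ.ord →
      ∀ i < τ.ord, ∃ j < τ.ord, supBelow p i ≤ supBelow q j := by
    intro p q hp h i hi
    have := hp.strictMono le_rfl hi
    rw [h, lt_supBelow_iff] at this
    obtain ⟨j, hj, hlt⟩ := this
    exact ⟨j + 1, hsucc j hj, hlt.le.trans (le_supBelow q (Order.lt_succ j))⟩
  refine ⟨fun i hi => hi.1, fun s hs hlt => ⟨hlt, ?_⟩, fun i₀ hi₀ => ?_⟩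
  · have hbdd : BddAbove s := ⟨τ.ord, fun i hi => (hs hi).1.le⟩
    by_cases hmem : sSup s ∈ s
    · exact (hs hmem).2
    have hlt' : ∀ j < sSup s, ∃ i ∈ s, j < i ∧ i ≤ sSup s := by
      intro j hj
      have hne : s.Nonempty := by
        rcases s.eq_empty_or_nonempty with rfl | hne
        · simp at hj
        · exact hne
      obtain ⟨i, hi, hji⟩ := exists_lt_of_lt_csSup hne hj
      exact ⟨i, hi, hji, le_csSup hbdd hi⟩
    refine le_antisymm (supBelow_le fun j hj => ?_) (supBelow_le fun j hj => ?_)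
    · obtain ⟨i, hi, hji, hle⟩ := hlt' j hj
      exact (le_supBelow p hji).trans ((hs hi).2.le.trans (supBelow_mono q hle))
    · obtain ⟨i, hi, hji, hle⟩ := hlt' j hj
      exact (le_supBelow q hji).trans ((hs hi).2.ge.trans (supBelow_mono p hle))
  · obtain ⟨x, hx0, hx, hlt⟩ := exists_nat_seq hτ hτ'
      (fun i j => supBelow p i ≤ supBelow q j ∧ supBelow q i ≤ supBelow p j) (by
        intro i hi
        obtain ⟨j, hj, hpq⟩ := key hp h i hi
        obtain ⟨k, hk, hqp⟩ := key hq h.symm i hi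
        refine ⟨max (i + 1) (max j k), max_lt (hsucc i hi) (max_lt hj hk),
          (Order.lt_succ i).trans_le (le_max_left _ _), hpq.trans (supBelow_mono q ?_),
          hqp.trans (supBelow_mono p ?_)⟩
        · exact (le_max_left _ _).trans (le_max_right _ _)
        · exact (le_max_right _ _).trans (le_max_right _ _)) hi₀
    have hle : ∀ n, x n ≤ ⨆ n, x n := fun n => Ordinal.le_iSup x n
    refine ⟨⨆ n, x n, ⟨hlt, le_antisymm (supBelow_le fun j hj => ?_)
      (supBelow_le fun j hj => ?_)⟩, by rw [← hx0]; exact (hx 0).1.trans_le (hle 1)⟩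
    · obtain ⟨n, hn⟩ := Ordinal.lt_iSup_iff.1 hj
      exact (le_supBelow p hn).trans ((hx n).2.1.trans (supBelow_mono q (hle _)))
    · obtain ⟨n, hn⟩ := Ordinal.lt_iSup_iff.1 hj
      exact (le_supBelow q hn).trans ((hx n).2.2.trans (supBelow_mono p (hle _)))

/-- The last point of `E` that is not above `i`. -/
noncomputable def lastBelow (E : Set Ordinal.{v}) (i : Ordinal.{v}) : Ordinal.{v} :=
  sSup (E ∩ Set.Iic i)

theorem lastBelow_le (E : Set Ordinal.{v}) (i : Ordinal.{v}) : lastBelow E i ≤ i :=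
  csSup_le' fun _ h => h.2

theorem lastBelow_mono {E F : Set Ordinal.{v}} {i j : Ordinal.{v}} (h : E ⊆ F) (hij : i ≤ j) :
    lastBelow E i ≤ lastBelow F j :=
  csSup_le' fun _ hk => le_csSup ⟨j, fun _ h => h.2⟩ ⟨h hk.1, hk.2.trans hij⟩

theorem le_lastBelow {E : Set Ordinal.{v}} {i j : Ordinal.{v}} (hj : j ∈ E) (hij : j ≤ i) :
    j ≤ lastBelow E i :=
  le_csSup ⟨i, fun _ h => h.2⟩ ⟨hj, hij⟩

theorem IsClubBelow.lastBelow_mem {o i : Ordinal.{v}} {E : Set Ordinal.{v}}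
    (hE : IsClubBelow o E) (hi : i < o) : lastBelow E i ∈ E :=
  hE.sSup_mem _ Set.inter_subset_left ((lastBelow_le E i).trans_lt hi)

/-- Every closed unbounded set has limit points of the shape `supBelow p θ.ord` with `p`
climbing. -/
theorem IsClubBelow.exists_climbs {θ τ : Cardinal.{v}} (hθ : θ.IsRegular) (hτ : τ.IsRegular)
    (hθτ : θ < τ)
    {E : Set Ordinal.{v}} (hE : IsClubBelow τ.ord E) :
    ∃ p, Climbs p θ.ord ∧ supBelow p θ.ord < τ.ord ∧
      ∀ i < supBelow p θ.ord, ∃ j ∈ E, i < j ∧ j < supBelow p θ.ord := by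
  obtain ⟨p, hp⟩ := exists_seq (S := Ordinal.{v})
    (fun ε p b => ε < θ.ord → (∀ j < ε, p j < τ.ord) → supBelow p ε < b ∧ b ∈ E)
    (fun ε g g' b h hR hε hlt => by
      rw [← supBelow_congr h]
      exact hR hε fun j hj => h j hj ▸ hlt j hj)
    (fun ε g => by
      by_cases h : ε < θ.ord ∧ ∀ j < ε, g j < τ.ord
      · obtain ⟨b, hb, hlt⟩ := hE.exists_gt (supBelow g ε) (supBelow_lt (by
          rw [hτ.cof_ord]
          exact (Cardinal.lt_ord.1 h.1).trans hθτ) h.2)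
        exact ⟨b, fun _ _ => ⟨hlt, hb⟩⟩
      · exact ⟨0, fun h₁ h₂ => absurd ⟨h₁, h₂⟩ h⟩)
  have hlt : ∀ j, j < θ.ord → p j < τ.ord := by
    intro j
    induction j using WellFoundedLT.induction with
    | _ j ih => exact fun hj => hE.lt _ (hp j hj fun k hk => ih k hk (hk.trans hj)).2
  have hp' := fun j (hj : j < θ.ord) => hp j hj fun k hk => hlt k (hk.trans hj)
  have hclimb : Climbs p θ.ord := fun j hj => (hp' j hj).1
  refine ⟨p, hclimb, supBelow_lt (by rwa [card_ord, hτ.cof_ord]) hlt,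
    fun i hi => ?_⟩
  obtain ⟨j, hj, hij⟩ := lt_supBelow_iff.1 hi
  exact ⟨p j, (hp' j hj).2, hij, hclimb.lt_supBelow (isSuccLimit_ord hθ.aleph0_le) hj⟩

/-- Club guessing: if `θ⁺ < τ` are regular, then there are `τ` many weakly increasing sequences
of length `θ` without last value such that each closed unbounded subset of `τ` contains all the
values of one of them.

If the sequences `ε ↦ lastBelow E (c ε)`, with `c` running over fixed continuous sequences, fail
to guess for every closed unbounded set `E`, then the failures give a decreasing sequence of `θ⁺`
closed unbounded sets. At a common limit point the `θ` many decreasing sequences of ordinals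
`lastBelow E (c ε)` are simultaneously constant from some stage on, and the next failure is
contradictory. -/
theorem exists_clubGuessing {θ τ : Cardinal.{v}} (hθ : θ.IsRegular) (hτ : τ.IsRegular)
    (h : Order.succ θ < τ) :
    ∃ e : Ordinal.{v} → Ordinal.{v} → Ordinal.{v}, ∀ D, IsClubBelow τ.ord D →
      ∃ α < τ.ord, (∀ ε < θ.ord, e α ε ∈ D) ∧ Monotone (e α) ∧
        ∀ ε < θ.ord, ∃ ε' < θ.ord, e α ε < e α ε' := by
  classical
  have hθτ : θ < τ := (Order.lt_succ θ).trans h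
  have hτ' : ℵ₀ < τ := hθ.aleph0_le.trans_lt hθτ
  have hsr : (Order.succ θ).IsRegular := isRegular_succ hθ.aleph0_le
  -- a continuous sequence of length `θ` converging to `α`, if there is one
  let P : Ordinal.{v} → Ordinal.{v} → Ordinal.{v} := fun α =>
    if h : ∃ p, Climbs p θ.ord ∧ supBelow p θ.ord = α then h.choose else 0
  have hP : ∀ α, (∃ p, Climbs p θ.ord ∧ supBelow p θ.ord = α) →
      Climbs (P α) θ.ord ∧ supBelow (P α) θ.ord = α := by
    intro α hα
    simp only [P, dif_pos hα]
    exact hα.choose_spec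
  -- `α` is a limit point of `E` to which such a sequence converges
  let G : Set Ordinal.{v} → Ordinal.{v} → Prop := fun E α => α < τ.ord ∧
    (∃ p, Climbs p θ.ord ∧ supBelow p θ.ord = α) ∧ ∀ i < α, ∃ j ∈ E, i < j ∧ j < α
  have main : ∃ E, IsClubBelow τ.ord E ∧ ∀ D, IsClubBelow τ.ord D →
      ∃ α, G E α ∧ ∀ ε < θ.ord, lastBelow E (supBelow (P α) ε) ∈ D := by
    by_contra! hcon
    choose! D hD hbad using hcon
    obtain ⟨E, hE⟩ := exists_seq (S := Set Ordinal.{v}) (fun ε E F => ε < (Order.succ θ).ord →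
      (∀ ζ < ε, IsClubBelow τ.ord (E ζ)) → IsClubBelow τ.ord F ∧ ∀ ζ < ε, F ⊆ E ζ ∩ D (E ζ))
      (fun ε g g' F hgg hR hε hcl => by
        have := hR hε fun ζ hζ => by rw [hgg ζ hζ]; exact hcl ζ hζ
        exact ⟨this.1, fun ζ hζ => hgg ζ hζ ▸ this.2 ζ hζ⟩)
      (fun ε g => by
        by_cases hh : ε < (Order.succ θ).ord ∧ ∀ ζ < ε, IsClubBelow τ.ord (g ζ)
        · rcases eq_or_ne ε 0 with rfl | h0
          · refine ⟨Set.Iio τ.ord, fun _ _ => ⟨⟨fun i hi => hi, fun s _ h => h, fun i hi =>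
              ⟨i + 1, ?_, Order.lt_succ i⟩⟩, by simp⟩⟩
            exact (isSuccLimit_ord hτ.aleph0_le).succ_lt hi
          · exact ⟨{i | ∀ ζ < ε, i ∈ g ζ ∩ D (g ζ)}, fun _ _ => ⟨IsClubBelow.biInter hτ hτ'
              ((Cardinal.lt_ord.1 hh.1).trans h) (pos_iff_ne_zero.2 h0) fun ζ hζ =>
                (hh.2 ζ hζ).inter hτ hτ' (hD _ (hh.2 ζ hζ)), fun ζ hζ i hi => hi ζ hζ⟩⟩
        · exact ⟨∅, fun h₁ h₂ => absurd ⟨h₁, h₂⟩ hh⟩)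
    have hcl : ∀ ε, ε < (Order.succ θ).ord → IsClubBelow τ.ord (E ε) := by
      intro ε
      induction ε using WellFoundedLT.induction with
      | _ ε ih => exact fun hε => (hE ε hε fun ζ hζ => ih ζ hζ (hζ.trans hε)).1
    have hsub : ∀ ε < (Order.succ θ).ord, ∀ ζ < ε, E ε ⊆ E ζ ∩ D (E ζ) := fun ε hε =>
      (hE ε hε fun ζ hζ => hcl ζ (hζ.trans hε)).2
    have hanti : ∀ ε < (Order.succ θ).ord, ∀ ζ ≤ ε, E ε ⊆ E ζ := by
      intro ε hε ζ hζ
      rcases hζ.eq_or_lt with rfl | hζ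
      · exact subset_rfl
      · exact fun i hi => (hsub ε hε ζ hζ hi).1
    have hinter : IsClubBelow τ.ord {i | ∀ ε < (Order.succ θ).ord, i ∈ E ε} :=
      IsClubBelow.biInter hτ hτ' (by rwa [card_ord]) hsr.ord_pos hcl
    obtain ⟨p, hp, hlt, hlim⟩ := hinter.exists_climbs hθ hτ hθτ
    set α := supBelow p θ.ord with hα
    have hG : ∀ ε < (Order.succ θ).ord, G (E ε) α := fun ε hε =>
      ⟨hlt, ⟨p, hp, hα.symm⟩, fun i hi => by
        obtain ⟨j, hj, hij⟩ := hlim i hi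
        exact ⟨j, hj ε hε, hij⟩⟩
    have hc : ∀ ε < θ.ord, supBelow (P α) ε < τ.ord := fun ε hε =>
      (supBelow_mono _ hε.le).trans_lt ((hP α ⟨p, hp, hα.symm⟩).2.trans_lt hlt)
    -- each of the decreasing sequences of ordinals attains its minimum
    have hmin : ∀ ε < θ.ord, ∃ ζ < (Order.succ θ).ord, ∀ ζ' < (Order.succ θ).ord,
        lastBelow (E ζ) (supBelow (P α) ε) ≤ lastBelow (E ζ') (supBelow (P α) ε) := by
      intro ε _
      obtain ⟨ζ, hζ, hmin⟩ := (wellFounded_lt (α := Ordinal.{v})).has_min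
        ((fun ζ => lastBelow (E ζ) (supBelow (P α) ε)) '' Set.Iio (Order.succ θ).ord)
        ⟨_, 0, hsr.ord_pos, rfl⟩
      obtain ⟨ζ, hζ', rfl⟩ := hζ
      exact ⟨ζ, hζ', fun ζ' hζ' => not_lt.1 (hmin _ ⟨ζ', hζ', rfl⟩)⟩
    choose! ζ hζ hmin using hmin
    obtain ⟨z, hz, hζz⟩ := exists_lt_forall_le (f := ζ) (c := θ.ord) (o := (Order.succ θ).ord)
      (by rw [card_ord, hsr.cof_ord]; exact Order.lt_succ θ) hζ
    have hz' : z + 1 < (Order.succ θ).ord := (isSuccLimit_ord hsr.aleph0_le).succ_lt hz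
    obtain ⟨ε, hε, hnot⟩ := hbad (E z) (hcl z hz) α (hG z hz)
    refine hnot ?_
    have heq : lastBelow (E z) (supBelow (P α) ε) = lastBelow (E (z + 1)) (supBelow (P α) ε) :=
      le_antisymm ((lastBelow_mono (hanti z hz _ (hζz ε hε)) le_rfl).trans (hmin ε hε _ hz'))
        (lastBelow_mono (hanti _ hz' _ (Order.le_succ z)) le_rfl)
    rw [heq]
    exact (hsub _ hz' z (Order.lt_succ z) ((hcl _ hz').lastBelow_mem (hc ε hε))).2
  obtain ⟨E, hE, hguess⟩ := main
  refine ⟨fun α ε => lastBelow E (supBelow (P α) ε), fun D hD => ?_⟩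
  obtain ⟨α, ⟨hα, hex, hlim⟩, hmem⟩ := hguess D hD
  refine ⟨α, hα, hmem, fun ε ε' hε => lastBelow_mono subset_rfl (supBelow_mono _ hε),
    fun ε hε => ?_⟩
  obtain ⟨hcl, hsup⟩ := hP α hex
  have h₁ : supBelow (P α) ε < α := (hcl.strictMono le_rfl hε).trans_eq hsup
  obtain ⟨j, hj, hij, hjα⟩ := hlim _ h₁
  rw [← hsup, lt_supBelow_iff] at hjα
  obtain ⟨k, hk, hjk⟩ := hjα
  refine ⟨k + 1, (isSuccLimit_ord hθ.aleph0_le).succ_lt hk, ?_⟩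
  exact (lastBelow_le _ _).trans_lt (hij.trans_le (le_lastBelow hj
    (hjk.le.trans (le_supBelow _ (Order.lt_succ k)))))

/-! ### Weak saturation and chains of sets -/

/-- A weakly `θ`-saturated ideal admits no `θ` many pairwise disjoint positive sets. -/
theorem WeaklySaturated.not_disjoint {X : Type v} {I : Order.Ideal (Set X)} {θ : Cardinal.{v}}
    (hsat : WeaklySaturated I θ) (hθ : θ ≠ 0) (W : Ordinal.{v} → Set X)
    (hdis : ∀ ε < θ.ord, ∀ ζ < ε, Disjoint (W ζ) (W ε)) (hpos : ∀ ε < θ.ord, W ε ∉ I) : False := by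
  classical
  have h0 : (0 : Ordinal.{v}) < θ.ord := by
    rw [Cardinal.lt_ord, Ordinal.card_zero]; exact pos_iff_ne_zero.2 hθ
  have hne : ∀ ε < θ.ord, (W ε).Nonempty := fun ε hε => by
    by_contra hemp
    rw [Set.not_nonempty_iff_eq_empty] at hemp
    exact hpos ε hε (hemp ▸ I.bot_mem)
  -- the points outside all the `W ε` join the piece of index `0`
  let π : X → Set.Iio θ.ord := fun x =>
    if h : ∃ ε < θ.ord, x ∈ W ε then ⟨h.choose, h.choose_spec.1⟩ else ⟨0, h0⟩
  have hπ : ∀ ε (hε : ε < θ.ord), ∀ x ∈ W ε, π x = ⟨ε, hε⟩ := by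
    intro ε hε x hx
    have h : ∃ ε < θ.ord, x ∈ W ε := ⟨ε, hε, hx⟩
    simp only [π, dif_pos h]
    obtain ⟨h₁, h₂⟩ := h.choose_spec
    rcases lt_trichotomy h.choose ε with hlt | heq | hlt
    · exact (Set.disjoint_left.1 (hdis ε hε _ hlt) h₂ hx).elim
    · exact Subtype.ext heq
    · exact (Set.disjoint_left.1 (hdis _ h₁ _ hlt) hx h₂).elim
  have hsub : ∀ ε : Set.Iio θ.ord, W ε ⊆ π ⁻¹' {ε} := fun ε x hx => hπ ε ε.2 x hx
  have hinj : Function.Injective fun ε : Set.Iio θ.ord => π ⁻¹' {ε} := by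
    intro ε ζ h
    obtain ⟨x, hx⟩ := hne ε ε.2
    have h₁ : π x = ε := hsub ε hx
    have h₂ : x ∈ π ⁻¹' {ζ} := by
      have : π ⁻¹' {ε} = π ⁻¹' {ζ} := h
      exact this ▸ hsub ε hx
    exact h₁.symm.trans h₂
  refine hsat ⟨Set.range fun ε : Set.Iio θ.ord => π ⁻¹' {ε}, ?_, ⟨?_, fun x => ?_⟩, ?_⟩
  · have := mk_range_eq_of_injective hinj
    rw [Cardinal.mk_Iio_ordinal, card_ord] at this
    exact Cardinal.lift_injective.{v + 1} (by simpa using this)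
  · rintro ⟨ε, hε⟩
    obtain ⟨x, hx⟩ := hne ε ε.2
    have : x ∈ (∅ : Set X) := hε ▸ hsub ε hx
    exact this
  · refine ⟨π ⁻¹' {π x}, ⟨⟨_, rfl⟩, rfl⟩, ?_⟩
    rintro _ ⟨⟨ε, rfl⟩, hx⟩
    rw [show π x = ε from hx]
  · rintro _ ⟨ε, rfl⟩ h
    exact hpos ε ε.2 (I.lower (hsub ε) h)

/-- An increasing chain of sets of length `θ` is constant modulo a weakly `θ`-saturated ideal from
some stage on. -/
theorem WeaklySaturated.exists_stable {X : Type v} {I : Order.Ideal (Set X)} {θ : Cardinal.{v}}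
    (hsat : WeaklySaturated I θ) (hθ : θ.IsRegular) (Y : Ordinal.{v} → Set X)
    (hY : ∀ ε < θ.ord, ∀ ζ ≤ ε, Y ζ ⊆ Y ε) :
    ∃ ε₀ < θ.ord, ∀ ε < θ.ord, Y ε \ Y ε₀ ∈ I := by
  by_contra! hcon
  choose! N hN using hcon
  obtain ⟨s, hs⟩ := exists_seq (S := Ordinal.{v}) (fun ε s b => ε < θ.ord →
      (∀ ζ < ε, s ζ < θ.ord) → b < θ.ord ∧ ∀ ζ < ε, N (s ζ) ≤ b)
    (fun ε s s' b h hR hε hlt => by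
      have := hR hε fun ζ hζ => (h ζ hζ).symm ▸ hlt ζ hζ
      exact ⟨this.1, fun ζ hζ => h ζ hζ ▸ this.2 ζ hζ⟩)
    (fun ε s => by
      by_cases h : ε < θ.ord ∧ ∀ ζ < ε, s ζ < θ.ord
      · obtain ⟨b, hb, hle⟩ := exists_lt_forall_le (f := fun ζ => N (s ζ)) (c := ε) (o := θ.ord)
          (by rw [hθ.cof_ord]; exact Cardinal.lt_ord.1 h.1) fun ζ hζ => (hN _ (h.2 ζ hζ)).1
        exact ⟨b, fun _ _ => ⟨hb, hle⟩⟩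
      · exact ⟨0, fun h₁ h₂ => absurd ⟨h₁, h₂⟩ h⟩)
  have hlt : ∀ ε, ε < θ.ord → s ε < θ.ord := by
    intro ε
    induction ε using WellFoundedLT.induction with
    | _ ε ih => exact fun hε => (hs ε hε fun ζ hζ => ih ζ hζ (hζ.trans hε)).1
  refine hsat.not_disjoint hθ.ne_zero (fun ε => Y (N (s ε)) \ Y (s ε)) (fun ε hε ζ hζ => ?_)
    fun ε hε => (hN _ (hlt ε hε)).2
  rw [Set.disjoint_left]
  intro x hx hx'
  exact hx'.2 (hY _ (hlt ε hε) _ ((hs ε hε fun ζ hζ => hlt ζ (hζ.trans hε)).2 ζ hζ) hx.1)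

/-- A decreasing chain of sets of length `θ` is constant modulo a weakly `θ`-saturated ideal from
some stage on. -/
theorem WeaklySaturated.exists_stable_anti {X : Type v} {I : Order.Ideal (Set X)}
    {θ : Cardinal.{v}} (hsat : WeaklySaturated I θ) (hθ : θ.IsRegular) (Y : Ordinal.{v} → Set X)
    (hY : ∀ ε < θ.ord, ∀ ζ ≤ ε, Y ε ⊆ Y ζ) :
    ∃ ε₀ < θ.ord, ∀ ε < θ.ord, Y ε₀ \ Y ε ∈ I := by
  obtain ⟨ε₀, h₀, h⟩ := hsat.exists_stable hθ (fun ε => (Y ε)ᶜ)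
    fun ε hε ζ hζ => Set.compl_subset_compl.2 (hY ε hε ζ hζ)
  refine ⟨ε₀, h₀, fun ε hε => ?_⟩
  have := h ε hε
  rwa [compl_sdiff_compl] at this

/-! ### Ideals and ultrafilters -/

theorem union_mem {X : Type v} {L : Order.Ideal (Set X)} {B C : Set X} (hB : B ∈ L) (hC : C ∈ L) :
    B ∪ C ∈ L :=
  Order.Ideal.sup_mem hB hC

/-- An ideal is disjoint from some ultrafilter containing a given nonempty sequence of positive
sets that decreases modulo the ideal. -/
theorem exists_ultrafilter {X : Type v} {L : Order.Ideal (Set X)} {o : Ordinal.{w}} (ho : 0 < o)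
    {W : Ordinal.{w} → Set X} (hdec : ∀ j < o, ∀ i ≤ j, W j \ W i ∈ L) (hW : ∀ i < o, W i ∉ L) :
    ∃ D : Ultrafilter X, DisjointFrom D L ∧ ∀ i < o, W i ∈ D := by
  let F : Filter X :=
    { sets := {Y | ∃ i < o, W i \ Y ∈ L}
      univ_sets := ⟨0, ho, by simpa using L.bot_mem⟩
      sets_of_superset := by
        rintro Y Z ⟨i, hi, hY⟩ hYZ
        exact ⟨i, hi, L.lower (Set.sdiff_subset_sdiff_right hYZ) hY⟩
      inter_sets := by
        rintro Y Z ⟨i, hi, hY⟩ ⟨j, hj, hZ⟩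
        refine ⟨max i j, max_lt hi hj, L.lower (fun x hx => ?_) (union_mem (union_mem
          (hdec _ (max_lt hi hj) i (le_max_left i j)) (hdec _ (max_lt hi hj) j (le_max_right i j)))
          (union_mem hY hZ))⟩
        simp only [Set.mem_union, Set.mem_sdiff, Set.mem_inter_iff] at hx ⊢
        tauto }
  have hF : F.NeBot := by
    refine ⟨fun h => ?_⟩
    have : (∅ : Set X) ∈ F := h ▸ Filter.mem_bot
    obtain ⟨i, hi, hWi⟩ := this
    exact hW i hi (by simpa using hWi)
  refine ⟨Ultrafilter.of F, fun B hB hBD => ?_, fun i hi => ?_⟩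
  · have : Bᶜ ∈ Ultrafilter.of F := by
      refine Ultrafilter.of_le F ⟨0, ho, L.lower ?_ hB⟩
      rintro x ⟨-, hx⟩
      simpa using hx
    exact Ultrafilter.compl_mem_iff_notMem.1 this hBD
  · exact Ultrafilter.of_le F ⟨i, hi, by simpa using L.bot_mem⟩

/-! ### Products and their cofinalities modulo ultrafilters -/

variable {A : Set Cardinal.{u}} {I : Order.Ideal (Set A)}

/-- The set of indices at which `f` is larger than `g`. For an ideal `L`, membership of this set
in `L` says that `f ≤ g` modulo `L`; for an ultrafilter `D`, nonmembership in `D` says that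
`f ≤ g` modulo `D`, and membership that `g < f` modulo `D`. -/
def exceed (f g : prod A) : Set A := {a | g.1 a < f.1 a}

theorem exceed_subset_union (f g h : prod A) : exceed f h ⊆ exceed f g ∪ exceed g h := by
  intro a ha
  rcases lt_or_ge (g.1 a) (f.1 a) with h' | h'
  · exact Or.inl h'
  · exact Or.inr (lt_of_lt_of_le ha h')

theorem exceed_trans {L : Order.Ideal (Set A)} {f g h : prod A} (hfg : exceed f g ∈ L)
    (hgh : exceed g h ∈ L) : exceed f h ∈ L :=
  L.lower (exceed_subset_union f g h) (union_mem hfg hgh)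

theorem exceed_eq_empty {f g : prod A} (h : ∀ a, f.1 a ≤ g.1 a) : exceed f g = ∅ :=
  Set.eq_empty_of_forall_notMem fun a ha => (h a).not_gt ha

theorem exceed_mem_of_le {L : Order.Ideal (Set A)} {f g : prod A} (h : ∀ a, f.1 a ≤ g.1 a) :
    exceed f g ∈ L :=
  exceed_eq_empty h ▸ L.bot_mem

theorem exceed_mono {f f' g g' : prod A} (hf : ∀ a, f.1 a ≤ f'.1 a) (hg : ∀ a, g'.1 a ≤ g.1 a) :
    exceed f g ⊆ exceed f' g' :=
  fun a ha => (hg a).trans_lt (ha.trans_le (hf a))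

/-- The pointwise maximum of two members of a product. -/
noncomputable def prodMax (f g : prod A) : prod A :=
  ⟨fun a => max (f.1 a) (g.1 a), fun a => max_lt (f.2 a) (g.2 a)⟩

theorem le_prodMax_left (f g : prod A) (a : A) : f.1 a ≤ (prodMax f g).1 a := le_max_left _ _

theorem le_prodMax_right (f g : prod A) (a : A) : g.1 a ≤ (prodMax f g).1 a := le_max_right _ _

theorem nonempty_prod (hA : ∀ a ∈ A, a.IsRegular) : Nonempty (prod A) :=
  ⟨⟨fun _ => 0, fun a => (hA a a.2).ord_pos⟩⟩

theorem exists_prod_succ (hA : ∀ a ∈ A, a.IsRegular) (f : prod A) :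
    ∃ g : prod A, ∀ a, f.1 a < g.1 a :=
  ⟨⟨fun a => f.1 a + 1, fun a => (isSuccLimit_ord (hA a a.2).aleph0_le).succ_lt (f.2 a)⟩,
    fun a => Order.lt_succ (f.1 a)⟩

/-- A family of `c` many functions has a common bound in the product, at all the coordinates larger
than `c`. -/
theorem exists_prod_bound (hA : ∀ a ∈ A, a.IsRegular) (c : Ordinal.{u + 1})
    (f : Ordinal.{u + 1} → prod A) :
    ∃ g : prod A, ∀ a : A, c.card < Cardinal.lift.{u + 1} (a : Cardinal.{u}) →
      ∀ i < c, (f i).1 a ≤ g.1 a := by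
  have h : ∀ a : A, ∃ b < (a : Cardinal.{u}).ord,
      c.card < Cardinal.lift.{u + 1} (a : Cardinal.{u}) → ∀ i < c, (f i).1 a ≤ b := by
    intro a
    by_cases ha : c.card < Cardinal.lift.{u + 1} (a : Cardinal.{u})
    · obtain ⟨b, hb, hle⟩ := exists_lt_forall_le_lift (f := fun i => (f i).1 a) (c := c)
        (o := (a : Cardinal.{u}).ord)
        (by rw [(hA a a.2).cof_ord, Cardinal.lift_id'.{u, u + 1}]; exact ha) fun i _ => (f i).2 a
      exact ⟨b, hb, fun _ => hle⟩
    · exact ⟨0, (hA a a.2).ord_pos, fun h => absurd h ha⟩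
  choose b hb hle using h
  exact ⟨⟨b, hb⟩, hle⟩

theorem exceed_notMem_iff (D : Ultrafilter A) (f g : prod A) :
    exceed f g ∉ D ↔ ((f.1 : Filter.Germ (D : Filter A) Ordinal.{u}) ≤ g.1) := by
  rw [Filter.Germ.coe_le, ← Ultrafilter.compl_mem_iff_notMem]
  have : (exceed f g)ᶜ = {a | f.1 a ≤ g.1 a} := by
    ext a; simp [exceed]
  rw [this]
  rfl

/-- A family that is cofinal modulo `D` bounds the cofinality of the ultraproduct. -/
theorem ultracof_le {D : Ultrafilter A} {f : Ordinal.{u + 1} → prod A} {c : Ordinal.{u + 1}}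
    (h : ∀ g : prod A, ∃ i < c, exceed g (f i) ∉ D) : ultracof A D ≤ c.card := by
  let F : Set.Iio c → ultraprod A D := fun i => ⟨((f i).1 : Filter.Germ (D : Filter A) _),
    Set.mem_image_of_mem _ (f i).2⟩
  have hF : IsCofinal (Set.range F) := by
    rintro ⟨_, g, hg, rfl⟩
    obtain ⟨i, hi, hgi⟩ := h ⟨g, hg⟩
    exact ⟨F ⟨i, hi⟩, ⟨_, rfl⟩, (exceed_notMem_iff D ⟨g, hg⟩ (f i)).1 hgi⟩
  refine (Order.cof_le hF).trans ?_
  rw [← Cardinal.lift_le.{u + 2}]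
  refine mk_range_le_lift.trans ?_
  simp [Cardinal.mk_Iio_ordinal]

theorem exists_cofinal_family (hA : ∀ a ∈ A, a.IsRegular) (D : Ultrafilter A) :
    ∃ f : Ordinal.{u + 1} → prod A, ∀ g : prod A, ∃ i < (ultracof A D).ord,
      exceed g (f i) ∉ D := by
  classical
  obtain ⟨z⟩ := nonempty_prod hA
  obtain ⟨s, hs, hcard⟩ := Order.exists_cof_eq (ultraprod A D)
  have hex : ∀ x : ultraprod A D, ∃ f : prod A,
      (f.1 : Filter.Germ (D : Filter A) Ordinal.{u}) = x := by
    rintro ⟨_, f, hf, rfl⟩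
    exact ⟨⟨f, hf⟩, rfl⟩
  choose F hF using hex
  have hcard' : #((ultracof A D).ord.ToType) = #s := by rw [mk_ord_toType, hcard]; rfl
  obtain ⟨e⟩ := Cardinal.eq.1 hcard'
  refine ⟨fun i => if h : i ∈ Set.Iio (ultracof A D).ord
    then F (e (Ordinal.ToType.mk ⟨i, h⟩)) else z, fun g => ?_⟩
  obtain ⟨y, hy, hgy⟩ := hs ⟨(g.1 : Filter.Germ (D : Filter A) Ordinal.{u}),
    Set.mem_image_of_mem _ g.2⟩
  have hlt : ((Ordinal.ToType.mk.symm (e.symm ⟨y, hy⟩) : Set.Iio (ultracof A D).ord) :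
    Ordinal.{u + 1}) < (ultracof A D).ord := (Ordinal.ToType.mk.symm (e.symm ⟨y, hy⟩)).2
  refine ⟨_, hlt, (exceed_notMem_iff _ _ _).2 ?_⟩
  simp only [Subtype.coe_prop, dite_true, Subtype.coe_eta, OrderIso.apply_symm_apply,
    Equiv.apply_symm_apply, hF]
  exact hgy

/-- Fewer functions than the cofinality have a strict bound modulo `D`. -/
theorem exists_strict_bound {D : Ultrafilter A} {c : Ordinal.{u + 1}}
    (hc : c.card < ultracof A D) (f : Ordinal.{u + 1} → prod A) :
    ∃ g : prod A, ∀ i < c, exceed g (f i) ∈ D := by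
  by_contra! h
  exact (ultracof_le h).not_gt hc

theorem exceed_asymm {D : Ultrafilter A} {f g : prod A} (h : exceed f g ∈ D) :
    exceed g f ∉ D := by
  intro h'
  obtain ⟨a, ha, ha'⟩ := Ultrafilter.nonempty_of_mem (Filter.inter_mem h h')
  exact lt_asymm (show g.1 a < f.1 a from ha) ha'

theorem exceed_mem_of_notMem {D : Ultrafilter A} {f g h : prod A} (hfh : exceed f h ∈ D)
    (hfg : exceed f g ∉ D) : exceed g h ∈ D :=
  (Ultrafilter.union_mem_iff.1
    (Filter.mem_of_superset hfh (exceed_subset_union f g h))).resolve_left hfg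

/-- If `B ∈ D` and all members of `B` are larger than `c`, the cofinality modulo `D` exceeds `c`. -/
theorem lt_ultracof (hA : ∀ a ∈ A, a.IsRegular) {D : Ultrafilter A} {c : Cardinal.{u + 1}}
    {B : Set A} (hB : B ∈ D) (hc : ∀ a ∈ B, c < Cardinal.lift.{u + 1} (a : Cardinal.{u})) :
    c < ultracof A D := by
  by_contra! hle
  obtain ⟨f, hf⟩ := exists_cofinal_family hA D
  obtain ⟨g, hg⟩ := exists_prod_bound hA c.ord f
  obtain ⟨g', hg'⟩ := exists_prod_succ hA g
  obtain ⟨i, hi, hgi⟩ := hf g'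
  refine hgi (Filter.mem_of_superset hB fun a ha => ?_)
  exact (hg a (by rw [card_ord]; exact hc a ha) i (hi.trans_le (ord_le_ord.2 hle))).trans_lt (hg' a)

/-- If `D` contains a finite set of cardinals at most `c`, the cofinality modulo `D` is at most
`c`, since `D` is then principal. -/
theorem ultracof_le_of_finite (hA : ∀ a ∈ A, a.IsRegular) {D : Ultrafilter A}
    {c : Cardinal.{u + 1}} {B : Set A} (hB : B ∈ D) (hfin : B.Finite)
    (hc : ∀ a ∈ B, Cardinal.lift.{u + 1} (a : Cardinal.{u}) ≤ c) : ultracof A D ≤ c := by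
  classical
  obtain ⟨a, ha, rfl⟩ := Ultrafilter.eq_pure_of_finite_mem hfin hB
  have hlift : ∀ b < (a : Cardinal.{u}).ord, Ordinal.lift.{u + 1} b < c.ord := by
    intro b hb
    rw [Cardinal.lt_ord, ← Ordinal.lift_card]
    exact (Cardinal.lift_lt.2 (Cardinal.lt_ord.1 hb)).trans_le (hc a ha)
  let f : Ordinal.{u + 1} → prod A := fun i =>
    ⟨fun a => if h : ∃ b < (a : Cardinal.{u}).ord, Ordinal.lift.{u + 1} b = i then h.choose else 0,
      fun a => by
        dsimp only
        split_ifs with h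
        · exact h.choose_spec.1
        · exact (hA a a.2).ord_pos⟩
  rw [← card_ord c]
  refine ultracof_le (f := f) fun g => ⟨Ordinal.lift.{u + 1} (g.1 a), hlift _ (g.2 a), ?_⟩
  have h : ∃ b < (a : Cardinal.{u}).ord, Ordinal.lift.{u + 1} b = Ordinal.lift.{u + 1} (g.1 a) :=
    ⟨_, g.2 a, rfl⟩
  have hfa : (f (Ordinal.lift.{u + 1} (g.1 a))).1 a = g.1 a := by
    simp only [f, dif_pos h]
    exact Ordinal.lift_inj.1 h.choose_spec.2
  rw [Ultrafilter.mem_pure]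
  intro hlt
  have : (f (Ordinal.lift.{u + 1} (g.1 a))).1 a < g.1 a := hlt
  exact this.ne hfa

theorem isRegular_ultracof (hA : ∀ a ∈ A, a.IsRegular) (D : Ultrafilter A)
    (h : ℵ₀ ≤ ultracof A D) : (ultracof A D).IsRegular := by
  refine ⟨h, not_lt.1 fun hlt => ?_⟩
  obtain ⟨f, hf⟩ := exists_cofinal_family hA D
  have hlim := isSuccLimit_ord h
  obtain ⟨p, hp, hcof⟩ := exists_cofinal_seq hlim.bot_lt
    (c := (ultracof A D).ord.cof) le_rfl
  have hseg : ∀ j, ∃ g : prod A, ∀ i < p j + 1, exceed g (f i) ∈ D := fun j =>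
    exists_strict_bound (Cardinal.lt_ord.1 (hlim.succ_lt (hp j))) f
  choose g hg using hseg
  obtain ⟨k, hk⟩ := exists_strict_bound (c := (ultracof A D).ord.cof.ord)
    (by rwa [card_ord]) g
  obtain ⟨i, hi, hki⟩ := hf k
  obtain ⟨j, hj, hij⟩ := hcof i hi
  refine hki (Filter.mem_of_superset (Filter.inter_mem (hk j hj) (hg j i
    (Order.lt_succ_iff.2 hij))) fun a ha => ?_)
  exact lt_trans (show (f i).1 a < (g j).1 a from ha.2) ha.1

/-! ### The ideals `J` and directedness of the product -/

theorem mem_J_of_mem {κ : Cardinal.{u + 1}} {B : Set A} (hB : B ∈ I) : B ∈ J A I κ :=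
  Or.inl hB

theorem ultracof_lt_of_mem_J {κ : Cardinal.{u + 1}} {B : Set A} (hB : B ∈ J A I κ)
    {D : Ultrafilter A} (hD : DisjointFrom D I) (hBD : B ∈ D) : ultracof A D < κ := by
  rcases hB with hB | hB
  · exact absurd hBD (hD B hB)
  · exact hB D hD hBD

theorem DisjointFrom.J {κ : Cardinal.{u + 1}} {D : Ultrafilter A} (hD : DisjointFrom D I)
    (h : κ ≤ ultracof A D) : DisjointFrom D (J A I κ) :=
  fun _ hB hBD => (ultracof_lt_of_mem_J hB hD hBD).not_ge h

theorem DisjointFrom.of_J {κ : Cardinal.{u + 1}} {D : Ultrafilter A}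
    (hD : DisjointFrom D (Pcf.J A I κ)) : DisjointFrom D I :=
  fun _ hB => hD _ (mem_J_of_mem hB)

theorem exists_ultrafilter_of_notMem_J {κ : Cardinal.{u + 1}} {B : Set A} (hB : B ∉ J A I κ) :
    ∃ D : Ultrafilter A, DisjointFrom D I ∧ B ∈ D ∧ κ ≤ ultracof A D := by
  by_contra! h
  exact hB (Or.inr h)

theorem J_mono {κ μ : Cardinal.{u + 1}} (h : κ ≤ μ) : J A I κ ≤ J A I μ := fun _ hB =>
  Or.inr fun _ hD hBD => (ultracof_lt_of_mem_J hB hD hBD).trans_le h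

/-- A sequence of length `o`, increasing modulo `J A I κ`, has a threshold `h`: the sequence exceeds
`h` on sets from `J A I μ` only. Otherwise one climbs for `θ` many steps: an ultrafilter on whose
product the whole sequence is bounded witnesses that `h` is no threshold, and the next candidate
takes such a bound into account. As `cof o > θ`, one index `i` serves for all the steps,
and the sets where the `i`-th function exceeds the candidates strictly decrease modulo `I`, which
weak saturation forbids. -/
theorem exists_threshold (hA : ∀ a ∈ A, a.IsRegular) {θ : Cardinal.{u + 1}} (hθ : θ.IsRegular)
    (hsat : WeaklySaturated I θ) (hθA : ∀ a ∈ A, θ < Cardinal.lift.{u + 1} a)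
    {κ μ : Cardinal.{u + 1}} (hκμ : κ ≤ μ) {o : Ordinal.{u + 1}} (ho : o.card < μ)
    (hcof : θ < o.cof) (f : Ordinal.{u + 1} → prod A)
    (hf : ∀ j < o, ∀ i ≤ j, exceed (f i) (f j) ∈ J A I κ) :
    ∃ h : prod A, ∀ i < o, exceed (f i) h ∈ J A I μ := by
  have := nonempty_prod hA
  by_contra! hcon
  choose i hi hnot using hcon
  choose D hD hmem hμ using fun h => exists_ultrafilter_of_notMem_J (hnot h)
  choose b hb using fun h => exists_strict_bound (ho.trans_le (hμ h)) f
  obtain ⟨g, hg⟩ := exists_seq (S := prod A) (fun ε g k => ε < θ.ord →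
      ∀ ζ < ε, ∀ a, (prodMax (g ζ) (b (g ζ))).1 a ≤ k.1 a)
    (fun ε g g' k h hR hε ζ hζ => h ζ hζ ▸ hR hε ζ hζ)
    (fun ε g => by
      obtain ⟨k, hk⟩ := exists_prod_bound hA ε fun ζ => prodMax (g ζ) (b (g ζ))
      exact ⟨k, fun hε ζ hζ a => hk a ((Cardinal.lt_ord.1 hε).trans (hθA a a.2)) ζ hζ⟩)
  obtain ⟨i₀, hi₀, hle⟩ := exists_lt_forall_le (f := fun ε => i (g ε)) (c := θ.ord) (o := o)
    (by rwa [card_ord]) fun ε _ => hi _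
  obtain ⟨ε, hε, hst⟩ := hsat.exists_stable_anti hθ (fun ε => exceed (f i₀) (g ε))
    (fun ε hε ζ hζ => by
      rcases hζ.eq_or_lt with rfl | hζ
      · exact subset_rfl
      · exact exceed_mono (fun _ => le_rfl) fun a => (le_prodMax_left _ _ a).trans (hg ε hε ζ hζ a))
  have hε' : ε + 1 < θ.ord := (isSuccLimit_ord hθ.aleph0_le).succ_lt hε
  refine hD (g ε) _ (hst _ hε') (Filter.inter_mem ?_ (Ultrafilter.compl_mem_iff_notMem.2 ?_))
  · exact exceed_mem_of_notMem (hmem (g ε))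
      ((hD (g ε)).J (hκμ.trans (hμ _)) _ (hf i₀ hi₀ _ (hle ε hε)))
  · intro h
    refine exceed_asymm (hb (g ε) i₀ hi₀) (Filter.mem_of_superset h
      (exceed_mono (fun _ => le_rfl) fun a => ?_))
    exact (le_prodMax_right _ _ a).trans (hg _ hε' ε (Order.lt_succ ε) a)

/-- Modulo `J A I κ`, fewer than `κ` functions have a common bound. -/
theorem exists_bound_mod_J (hA : ∀ a ∈ A, a.IsRegular) {θ : Cardinal.{u + 1}} (hθ : θ.IsRegular)
    (hsat : WeaklySaturated I θ) (hθA : ∀ a ∈ A, θ < Cardinal.lift.{u + 1} a)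
    {κ : Cardinal.{u + 1}} {o : Ordinal.{u + 1}} (ho : o.card < κ)
    (f : Ordinal.{u + 1} → prod A) :
    ∃ g : prod A, ∀ i < o, exceed (f i) g ∈ J A I κ := by
  have := nonempty_prod hA
  induction o using WellFoundedLT.induction generalizing f with
  | _ o ih =>
  rcases eq_or_ne o 0 with rfl | h0
  · exact ⟨Classical.arbitrary _, fun i hi => absurd hi (by simp)⟩
  -- replace `f` by a larger sequence that increases modulo `J`
  obtain ⟨f', hf'⟩ := exists_seq (S := prod A) (fun i g k => i < o →
      (∀ a, (f i).1 a ≤ k.1 a) ∧ ∀ j < i, exceed (g j) k ∈ J A I κ)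
    (fun i g g' k h hR hi => ⟨(hR hi).1, fun j hj => h j hj ▸ (hR hi).2 j hj⟩)
    (fun i g => by
      by_cases hi : i < o
      · obtain ⟨k, hk⟩ := ih i hi ((Ordinal.card_le_card hi.le).trans_lt ho) g
        exact ⟨prodMax (f i) k, fun _ => ⟨le_prodMax_left _ _, fun j hj =>
          exceed_trans (hk j hj) (exceed_mem_of_le (le_prodMax_right _ _))⟩⟩
      · exact ⟨Classical.arbitrary _, fun h => absurd h hi⟩)
  have hinc : ∀ j < o, ∀ i ≤ j, exceed (f' i) (f' j) ∈ J A I κ := by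
    intro j hj i hij
    rcases hij.eq_or_lt with rfl | hij
    · exact exceed_mem_of_le fun _ => le_rfl
    · exact (hf' j hj).2 i hij
  obtain ⟨g, hg⟩ : ∃ g : prod A, ∀ i < o, exceed (f' i) g ∈ J A I κ := by
    rcases le_or_gt o.cof θ with hcof | hcof
    · obtain ⟨p, hp, hpo⟩ := exists_cofinal_seq (pos_iff_ne_zero.2 h0) hcof
      obtain ⟨g, hg⟩ := exists_prod_bound hA θ.ord fun j => f' (p j)
      refine ⟨g, fun i hi => ?_⟩
      obtain ⟨j, hj, hij⟩ := hpo i hi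
      exact exceed_trans (hinc _ (hp j) i hij)
        (exceed_mem_of_le fun a => hg a (by rw [card_ord]; exact hθA a a.2) j hj)
    · exact exists_threshold hA hθ hsat hθA le_rfl ho hcof f' hinc
  exact ⟨g, fun i hi => exceed_trans (exceed_mem_of_le (hf' i hi).1) (hg i hi)⟩

/-- An ultrafilter disjoint from `J A I κ` yields cofinality at least `κ`. -/
theorem le_ultracof (hA : ∀ a ∈ A, a.IsRegular) {θ : Cardinal.{u + 1}} (hθ : θ.IsRegular)
    (hsat : WeaklySaturated I θ) (hθA : ∀ a ∈ A, θ < Cardinal.lift.{u + 1} a)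
    {κ : Cardinal.{u + 1}} {D : Ultrafilter A} (hD : DisjointFrom D (J A I κ)) :
    κ ≤ ultracof A D := by
  by_contra! hlt
  obtain ⟨f, hf⟩ := exists_cofinal_family hA D
  obtain ⟨g, hg⟩ := exists_bound_mod_J hA hθ hsat hθA (by rwa [card_ord]) f
  obtain ⟨g', hg'⟩ := exists_prod_succ hA g
  obtain ⟨i, hi, hgi⟩ := hf g'
  refine hD _ (hg i hi) (Filter.mem_of_superset (Ultrafilter.compl_mem_iff_notMem.2 hgi) ?_)
  intro a ha
  exact (hg' a).trans_le (not_lt.1 ha)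

/-! ### Universal sequences -/

/-- The sequence `f` of length `κ` increases modulo `J A I κ`. -/
def IncreasingModJ (I : Order.Ideal (Set A)) (κ : Cardinal.{u + 1})
    (f : Ordinal.{u + 1} → prod A) : Prop :=
  ∀ j < κ.ord, ∀ i ≤ j, exceed (f i) (f j) ∈ J A I κ

/-- There is a sequence of length `κ` that increases modulo `J A I κ` and whose value at each stage
is everywhere above a prescribed function `Φ` of the earlier values. -/
theorem exists_increasing_above (hA : ∀ a ∈ A, a.IsRegular) {θ : Cardinal.{u + 1}}
    (hθ : θ.IsRegular) (hsat : WeaklySaturated I θ)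
    (hθA : ∀ a ∈ A, θ < Cardinal.lift.{u + 1} a) (κ : Cardinal.{u + 1})
    (Φ : Ordinal.{u + 1} → (Ordinal.{u + 1} → prod A) → prod A)
    (hΦ : ∀ i g g', (∀ j < i, g j = g' j) → Φ i g = Φ i g') :
    ∃ f, IncreasingModJ I κ f ∧ ∀ i < κ.ord, ∀ a, (Φ i f).1 a ≤ (f i).1 a := by
  have := nonempty_prod hA
  obtain ⟨f, hf⟩ := exists_seq (S := prod A) (fun i g k => i < κ.ord →
      (∀ a, (Φ i g).1 a ≤ k.1 a) ∧ ∀ j < i, exceed (g j) k ∈ J A I κ)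
    (fun i g g' k h hR hi => ⟨hΦ i g g' h ▸ (hR hi).1, fun j hj => h j hj ▸ (hR hi).2 j hj⟩)
    (fun i g => by
      by_cases hi : i < κ.ord
      · obtain ⟨k, hk⟩ := exists_bound_mod_J hA hθ hsat hθA (Cardinal.lt_ord.1 hi) g
        exact ⟨prodMax (Φ i g) k, fun _ => ⟨le_prodMax_left _ _, fun j hj =>
          exceed_trans (hk j hj) (exceed_mem_of_le (le_prodMax_right _ _))⟩⟩
      · exact ⟨Classical.arbitrary _, fun h => absurd h hi⟩)
  refine ⟨f, fun j hj i hij => ?_, fun i hi => (hf i hi).1⟩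
  rcases hij.eq_or_lt with rfl | hij
  · exact exceed_mem_of_le fun _ => le_rfl
  · exact (hf j hj).2 i hij

/-- The sequence `f` of length `κ` is cofinal modulo every ultrafilter of cofinality `κ` that is
disjoint from `I`. -/
def Universal (I : Order.Ideal (Set A)) (κ : Cardinal.{u + 1})
    (f : Ordinal.{u + 1} → prod A) : Prop :=
  ∀ D : Ultrafilter A, DisjointFrom D I → ultracof A D = κ →
    ∀ g : prod A, ∃ i < κ.ord, exceed g (f i) ∉ D

/-- Universal sequences exist. Otherwise one passes for `θ` many steps from a sequence to a larger
one that is cofinal modulo an ultrafilter modulo which the given one is bounded, and compares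
the sequences with the supremum `h` of their first entries: at a large enough index `i`, the sets
where the `i`-th entries are at least `h` strictly increase modulo `I`. -/
theorem exists_universal (hA : ∀ a ∈ A, a.IsRegular) {θ : Cardinal.{u + 1}} (hθ : θ.IsRegular)
    (hsat : WeaklySaturated I θ) (hθA : ∀ a ∈ A, θ < Cardinal.lift.{u + 1} a)
    {κ : Cardinal.{u + 1}} (hκ : κ.IsRegular) (hθκ : θ < κ) :
    ∃ f : Ordinal.{u + 1} → prod A, Universal I κ f := by
  have := nonempty_prod hA
  by_contra! hcon
  simp only [Universal, not_forall, not_exists, not_and, not_not] at hcon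
  choose D hD hκD b hb using hcon
  choose k hk using fun f => exists_cofinal_family hA (D f)
  obtain ⟨F, hF⟩ := exists_seq (S := Ordinal.{u + 1} → prod A) (fun ε F f => ε < θ.ord →
      IncreasingModJ I κ f ∧ ∀ ζ < ε, ∀ i < κ.ord, ∀ a,
        max ((F ζ i).1 a) (max ((b (F ζ)).1 a) ((k (F ζ) i).1 a)) ≤ (f i).1 a)
    (fun ε F F' f h hR hε => ⟨(hR hε).1, fun ζ hζ => h ζ hζ ▸ (hR hε).2 ζ hζ⟩)
    (fun ε F => by
      choose s hs using fun i => exists_prod_bound hA ε fun ζ =>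
        prodMax (F ζ i) (prodMax (b (F ζ)) (k (F ζ) i))
      obtain ⟨f, hf, hsf⟩ := exists_increasing_above hA hθ hsat hθA κ (fun i _ => s i)
        fun _ _ _ _ => rfl
      exact ⟨f, fun hε => ⟨hf, fun ζ hζ i hi a =>
        (hs i a ((Cardinal.lt_ord.1 hε).trans (hθA a a.2)) ζ hζ).trans (hsf i hi a)⟩⟩)
  have hlim := isSuccLimit_ord hθ.aleph0_le
  have hF₁ : ∀ ε < θ.ord, ∀ ζ < ε, ∀ i < κ.ord, ∀ a, (F ζ i).1 a ≤ (F ε i).1 a :=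
    fun ε hε ζ hζ i hi a => (le_max_left _ _).trans ((hF ε hε).2 ζ hζ i hi a)
  have hF₂ : ∀ ε < θ.ord, ∀ ζ < ε, ∀ i < κ.ord, ∀ a, (b (F ζ)).1 a ≤ (F ε i).1 a :=
    fun ε hε ζ hζ i hi a => ((le_max_left _ _).trans (le_max_right _ _)).trans
      ((hF ε hε).2 ζ hζ i hi a)
  have hF₃ : ∀ ε < θ.ord, ∀ ζ < ε, ∀ i < κ.ord, ∀ a, (k (F ζ) i).1 a ≤ (F ε i).1 a :=
    fun ε hε ζ hζ i hi a => ((le_max_right _ _).trans (le_max_right _ _)).trans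
      ((hF ε hε).2 ζ hζ i hi a)
  obtain ⟨h, hh⟩ := exists_prod_bound hA θ.ord fun ε => F ε 0
  have hh' : ∀ ε < θ.ord, ∀ a, (F ε 0).1 a ≤ h.1 a := fun ε hε a =>
    hh a (by rw [card_ord]; exact hθA a a.2) ε hε
  have hdom : ∀ ε, ∃ i < κ.ord, exceed h (k (F ε) i) ∉ D (F ε) := fun ε => by
    obtain ⟨i, hi, hi'⟩ := hk (F ε) h
    exact ⟨i, hκD (F ε) ▸ hi, hi'⟩
  choose i hi hih using hdom
  obtain ⟨i₀, hi₀, hle⟩ := exists_lt_forall_le (f := i) (c := θ.ord) (o := κ.ord)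
    (by rwa [card_ord, hκ.cof_ord]) fun ε _ => hi ε
  obtain ⟨ε, hε, hst⟩ := hsat.exists_stable_anti hθ (fun ε => exceed h (F ε i₀))
    (fun ε hε ζ hζ => by
      rcases hζ.eq_or_lt with rfl | hζ
      · exact subset_rfl
      · exact exceed_mono (fun _ => le_rfl) (hF₁ ε hε ζ hζ i₀ hi₀))
  have hε' : ε + 1 < θ.ord := hlim.succ_lt hε
  have hεε : ε < ε + 1 := Order.lt_succ ε
  refine hD (F ε) _ (hst _ hε') ?_
  have h₁ : exceed h (F ε i₀) ∈ D (F ε) :=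
    Filter.mem_of_superset (hb (F ε) i₀ hi₀) (exceed_mono (fun a =>
      (hF₂ _ hε' ε hεε 0 hκ.ord_pos a).trans (hh' _ hε' a)) fun _ => le_rfl)
  have h₂ : exceed h (F (ε + 1) i₀) ∉ D (F ε) := by
    intro hmem
    refine (Ultrafilter.union_mem_iff.1 (Filter.mem_of_superset hmem
      (exceed_subset_union h (F (ε + 1) (i ε)) (F (ε + 1) i₀)))).elim (fun h₃ => ?_) ?_
    · exact hih ε (Filter.mem_of_superset h₃ (exceed_mono (fun _ => le_rfl)
        (hF₃ _ hε' ε hεε (i ε) (hi ε))))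
    · exact (hD (F ε)).J (hκD (F ε)).ge _ ((hF _ hε').1 i₀ hi₀ (i ε) (hle ε hε))
  exact Filter.inter_mem h₁ (Ultrafilter.compl_mem_iff_notMem.2 h₂)

/-! ### Sequences that respect suprema of length `τ` -/

/-- There is an increasing universal sequence `f` with the following property at each point `δ` that
is the limit of a continuous sequence of length `τ`: for one such sequence `supBelow (Q δ)`, the
function `f δ` bounds all the functions along it, at all the coordinates larger than `τ`. -/
theorem exists_continuous_universal (hA : ∀ a ∈ A, a.IsRegular) {θ : Cardinal.{u + 1}}
    (hθ : θ.IsRegular) (hsat : WeaklySaturated I θ)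
    (hθA : ∀ a ∈ A, θ < Cardinal.lift.{u + 1} a) {κ : Cardinal.{u + 1}} (hκ : κ.IsRegular)
    (hθκ : θ < κ) (τ : Cardinal.{u + 1}) :
    ∃ (f : Ordinal.{u + 1} → prod A) (Q : Ordinal.{u + 1} → Ordinal.{u + 1} → Ordinal.{u + 1}),
      IncreasingModJ I κ f ∧ Universal I κ f ∧
      ∀ δ < κ.ord, (∃ p, Climbs p τ.ord ∧ supBelow p τ.ord = δ) →
        Climbs (Q δ) τ.ord ∧ supBelow (Q δ) τ.ord = δ ∧
        ∀ a : A, τ < Cardinal.lift.{u + 1} (a : Cardinal.{u}) → ∀ i < τ.ord,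
          (f (supBelow (Q δ) i)).1 a ≤ (f δ).1 a := by
  classical
  obtain ⟨f₀, hf₀⟩ := exists_universal (κ := κ) hA hθ hsat hθA hκ hθκ
  let Q : Ordinal.{u + 1} → Ordinal.{u + 1} → Ordinal.{u + 1} := fun δ =>
    if h : ∃ p, Climbs p τ.ord ∧ supBelow p τ.ord = δ then h.choose else 0
  have hQ : ∀ δ, (∃ p, Climbs p τ.ord ∧ supBelow p τ.ord = δ) →
      Climbs (Q δ) τ.ord ∧ supBelow (Q δ) τ.ord = δ := by
    intro δ hδ
    simp only [Q, dif_pos hδ]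
    exact hδ.choose_spec
  choose b hb using exists_prod_bound hA τ.ord
  obtain ⟨f, hf, hΦ⟩ := exists_increasing_above hA hθ hsat hθA κ
    (fun δ g => prodMax (f₀ δ)
      (b fun i => if supBelow (Q δ) i < δ then g (supBelow (Q δ) i) else f₀ 0))
    (fun δ g g' h => by
      congr 2
      funext i
      split_ifs with hi
      · exact h _ hi
      · rfl)
  refine ⟨f, Q, hf, fun D hD hDκ g => ?_, fun δ hδ hex => ?_⟩
  · obtain ⟨i, hi, hgi⟩ := hf₀ D hD hDκ g
    exact ⟨i, hi, fun h => hgi (Filter.mem_of_superset h (exceed_mono (fun _ => le_rfl)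
      fun a => (le_prodMax_left _ _ a).trans (hΦ i hi a)))⟩
  · obtain ⟨hcl, hsup⟩ := hQ δ hex
    refine ⟨hcl, hsup, fun a ha i hi => ?_⟩
    have hlt : supBelow (Q δ) i < δ := (hcl.strictMono le_rfl hi).trans_eq hsup
    have := hb (fun i => if supBelow (Q δ) i < δ then f (supBelow (Q δ) i) else f₀ 0) a
      (by rwa [card_ord]) i hi
    simp only [if_pos hlt] at this
    exact this.trans ((le_prodMax_right _ _ a).trans (hΦ δ hδ a))

/-! ### Generators -/

/-- Beyond a threshold, a universal sequence absorbs each member of `J A I κ⁺`. -/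
theorem Universal.exists_sdiff_mem_J (hA : ∀ a ∈ A, a.IsRegular) {θ : Cardinal.{u + 1}}
    (hθ : θ.IsRegular) (hsat : WeaklySaturated I θ)
    (hθA : ∀ a ∈ A, θ < Cardinal.lift.{u + 1} a) {κ : Cardinal.{u + 1}} (hκ : κ.IsRegular)
    {f : Ordinal.{u + 1} → prod A} (hf : IncreasingModJ I κ f) (hu : Universal I κ f)
    (h : prod A) {B : Set A} (hB : B ∈ J A I (Order.succ κ)) :
    ∃ i < κ.ord, B \ exceed (f i) h ∈ J A I κ := by
  by_contra! hcon
  obtain ⟨D, hD, hmem⟩ := exists_ultrafilter hκ.ord_pos (L := J A I κ)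
    (W := fun i => B \ exceed (f i) h) (fun j hj i hij => (J A I κ).lower (fun a ha => by
      have h₁ : a ∈ exceed (f i) h := by
        by_contra h₁
        exact ha.2 ⟨ha.1.1, h₁⟩
      exact (exceed_subset_union (f i) (f j) h h₁).resolve_right ha.1.2) (hf j hj i hij)) hcon
  have hBD : B ∈ D := Filter.mem_of_superset (hmem 0 hκ.ord_pos) fun a ha => ha.1
  have hDI : DisjointFrom D I := hD.of_J
  have hcard : ultracof A D = κ := le_antisymm
    (Order.lt_succ_iff.1 (ultracof_lt_of_mem_J hB hDI hBD)) (le_ultracof hA hθ hsat hθA hD)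
  obtain ⟨g, hg⟩ := exists_prod_succ hA h
  obtain ⟨i, hi, hgi⟩ := hu D hDI hcard g
  obtain ⟨a, ha, ha'⟩ := Ultrafilter.nonempty_of_mem (Filter.inter_mem (hmem i hi)
    (Ultrafilter.compl_mem_iff_notMem.2 hgi))
  exact ha.2 ((hg a).trans_le (not_lt.1 ha'))

/-- A set in `J A I κ⁺` that contains each such set modulo `J A I κ` is a generator. -/
theorem isGenerator_of_forall_sdiff_mem {κ : Cardinal.{u + 1}} {B : Set A}
    (hB : B ∈ J A I (Order.succ κ)) (h : ∀ C ∈ J A I (Order.succ κ), C \ B ∈ J A I κ) :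
    IsGenerator A I κ B := by
  refine ⟨⟨J_mono (Order.le_succ κ), hB⟩, fun K ⟨hJK, hBK⟩ C hC => ?_⟩
  refine K.lower (fun a ha => ?_) (union_mem (hJK (h C hC)) hBK)
  by_cases haB : a ∈ B
  · exact Or.inr haB
  · exact Or.inl ⟨ha, haB⟩

/-- The cardinals in `A` above `θ` that are at most `θ⁺⁺` are finite in number. -/
theorem finite_le_succ_succ {θ : Cardinal.{u + 1}}
    (hθA : ∀ a ∈ A, θ < Cardinal.lift.{u + 1} a) :
    {a : A | Cardinal.lift.{u + 1} (a : Cardinal.{u}) ≤ Order.succ (Order.succ θ)}.Finite := by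
  refine Set.Finite.of_finite_image (f := fun a : A => Cardinal.lift.{u + 1} (a : Cardinal.{u}))
    ((Set.toFinite {Order.succ θ, Order.succ (Order.succ θ)}).subset ?_) ?_
  · rintro _ ⟨a, ha, rfl⟩
    have h₁ : Order.succ θ ≤ Cardinal.lift.{u + 1} (a : Cardinal.{u}) :=
      Order.succ_le_of_lt (hθA a a.2)
    rcases h₁.eq_or_lt with h₁ | h₁
    · exact Or.inl h₁.symm
    · exact Or.inr (le_antisymm ha (Order.succ_le_of_lt h₁))
  · intro a _ b _ hab
    exact Subtype.ext (Cardinal.lift_injective.{u + 1} hab)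

/-- If `κ ≤ θ⁺⁺`, the finite set of the members of `A` that are at most `κ` is a generator:
an ultrafilter not containing it has cofinality above `κ`. -/
theorem isGenerator_of_le_succ_succ (hA : ∀ a ∈ A, a.IsRegular) {θ κ : Cardinal.{u + 1}}
    (hθA : ∀ a ∈ A, θ < Cardinal.lift.{u + 1} a) (hκ : κ ≤ Order.succ (Order.succ θ)) :
    IsGenerator A I κ {a | Cardinal.lift.{u + 1} (a : Cardinal.{u}) ≤ κ} := by
  refine isGenerator_of_forall_sdiff_mem (Or.inr fun D hD hBD => ?_) fun C hC =>
    Or.inr fun D hD hCD => ?_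
  · exact Order.lt_succ_iff.2 (ultracof_le_of_finite hA hBD
      ((finite_le_succ_succ hθA).subset fun a ha => ha.trans hκ) fun a ha => ha)
  · have h₁ : κ < ultracof A D := lt_ultracof hA hCD fun a ha => not_le.1 ha.2
    have h₂ := ultracof_lt_of_mem_J hC hD (Filter.mem_of_superset hCD Set.sdiff_subset)
    exact absurd (Order.lt_succ_iff.1 h₂) h₁.not_ge

/-- Generators exist if `κ > θ⁺⁺`. Let `f` be a universal sequence with threshold `h`, respecting
suprema of length `τ = θ⁺⁺`, and let `B i` be the set where `f i` exceeds `h`. If there is no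
generator, the sets `B i` never stop growing modulo `J A I κ`. Choose a continuous sequence
`supBelow p` of length `τ` along which they grow, such that in addition `f (p j)` bounds, if
possible, the functions at the places `supBelow p (e α ε) ≤ supBelow p j` for each of the `τ` many
guessing sequences `e α`. At the supremum `δ` of the sequence, a club of places lies on the sequence
`supBelow (Q δ)` below `f δ`. If `e α` guesses this club, the bounds are possible for `e α`, so that
modulo `J A I κ` the union `W ε` of the `B (supBelow p (e α ζ))` over `ζ ≤ ε` is contained in a
later set of the sequence. Hence the chain of the `W ε`, of length `θ`, grows cofinally often by
positive sets, contrary to weak `θ`-saturation. -/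
theorem exists_isGenerator_of_lt (hA : ∀ a ∈ A, a.IsRegular) {θ : Cardinal.{u + 1}}
    (hθ : θ.IsRegular) (hsat : WeaklySaturated I θ)
    (hθA : ∀ a ∈ A, θ < Cardinal.lift.{u + 1} a) {κ : Cardinal.{u + 1}} (hκ : κ.IsRegular)
    (hτκ : Order.succ (Order.succ θ) < κ) : ∃ B : Set A, IsGenerator A I κ B := by
  set τ := Order.succ (Order.succ θ) with hτdef
  have hτ : τ.IsRegular := isRegular_succ (hθ.aleph0_le.trans (Order.le_succ θ))
  have hθτ : θ < τ := (Order.lt_succ θ).trans (Order.lt_succ _)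
  have hτ' : ℵ₀ < τ := hθ.aleph0_le.trans_lt hθτ
  obtain ⟨f, Q, hf, hu, hQ⟩ :=
    exists_continuous_universal (κ := κ) hA hθ hsat hθA hκ (hθτ.trans hτκ) τ
  obtain ⟨h, hh⟩ := exists_threshold (μ := Order.succ κ) (o := κ.ord) hA hθ hsat hθA
    (Order.le_succ κ) (by rw [card_ord]; exact Order.lt_succ κ)
    (by rw [hκ.cof_ord]; exact hθτ.trans hτκ) f hf
  obtain ⟨e, he⟩ := exists_clubGuessing hθ hτ (Order.lt_succ (Order.succ θ))
  by_contra! hcon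
  have hsmall : {a : A | Cardinal.lift.{u + 1} (a : Cardinal.{u}) ≤ τ} ∈ J A I κ :=
    Or.inr fun D _ hBD => (ultracof_le_of_finite hA hBD (finite_le_succ_succ hθA)
      fun a ha => ha).trans_lt hτκ
  have hBmono : ∀ j < κ.ord, ∀ i ≤ j, exceed (f i) h \ exceed (f j) h ∈ J A I κ :=
    fun j hj i hij => (J A I κ).lower (fun a ha =>
      (exceed_subset_union (f i) (f j) h ha.1).resolve_right ha.2) (hf j hj i hij)
  have sdiff_trans : ∀ {B C E : Set A}, B \ C ∈ J A I κ → C \ E ∈ J A I κ → B \ E ∈ J A I κ :=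
    fun {B C E} h₁ h₂ => (J A I κ).lower (fun a ha => by
      by_cases haC : a ∈ C
      · exact Or.inr ⟨haC, ha.2⟩
      · exact Or.inl ⟨ha.1, haC⟩) (union_mem h₁ h₂)
  have hgrow : ∀ i < κ.ord, ∃ j < κ.ord, exceed (f j) h \ exceed (f i) h ∉ J A I κ := by
    intro i hi
    by_contra! hno
    refine hcon _ (isGenerator_of_forall_sdiff_mem (hh i hi) fun C hC => ?_)
    obtain ⟨j, hj, hCj⟩ := hu.exists_sdiff_mem_J hA hθ hsat hθA hκ hf h hC
    exact sdiff_trans hCj (hno j hj)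
  -- `σ` bounds `f` at the places of the sequence numbered by values of `e α` up to `j`
  let Good : (Ordinal.{u + 1} → Ordinal.{u + 1}) → Ordinal.{u + 1} → Ordinal.{u + 1} →
      Ordinal.{u + 1} → Prop := fun p j α σ =>
    {a | ∃ ε < θ.ord, e α ε ≤ j ∧ a ∈ exceed (f (supBelow p (e α ε))) (f σ)} ∈ J A I κ
  have good_congr : ∀ {p p' j α σ}, (∀ k < j, p k = p' k) → Good p j α σ → Good p' j α σ := by
    intro p p' j α σ hpp hg
    refine (J A I κ).lower ?_ hg
    rintro a ⟨ε, hε, hle, ha⟩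
    refine ⟨ε, hε, hle, ?_⟩
    rwa [supBelow_congr fun k hk => hpp k (hk.trans_le hle)]
  have good_mono : ∀ {p j α σ σ'}, σ ≤ σ' → σ' < κ.ord → Good p j α σ → Good p j α σ' := by
    intro p j α σ σ' hle hlt hg
    refine (J A I κ).lower ?_ (union_mem hg (hf σ' hlt σ hle))
    rintro a ⟨ε, hε, hej, ha⟩
    rcases exceed_subset_union _ (f σ) _ ha with ha | ha
    · exact Or.inl ⟨ε, hε, hej, ha⟩
    · exact Or.inr ha
  obtain ⟨p, hp⟩ := exists_seq (S := Ordinal.{u + 1}) (fun j p b => j < τ.ord →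
      (∀ k < j, p k < κ.ord) → b < κ.ord ∧ supBelow p j < b ∧
        exceed (f b) h \ exceed (f (supBelow p j)) h ∉ J A I κ ∧
        ∀ α < τ.ord, (∃ σ < κ.ord, Good p j α σ) → Good p j α b)
    (fun j p p' b hpp hR hj hlt => by
      obtain ⟨h₁, h₂, h₃, h₄⟩ := hR hj fun k hk => (hpp k hk).symm ▸ hlt k hk
      rw [supBelow_congr hpp] at h₂ h₃
      exact ⟨h₁, h₂, h₃, fun α hα ⟨σ, hσ, hg⟩ => good_congr hpp
        (h₄ α hα ⟨σ, hσ, good_congr (fun k hk => (hpp k hk).symm) hg⟩)⟩)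
    (fun j p => by
      by_cases hyp : j < τ.ord ∧ ∀ k < j, p k < κ.ord
      swap
      · exact ⟨0, fun h₁ h₂ => absurd ⟨h₁, h₂⟩ hyp⟩
      have hsup : supBelow p j < κ.ord := supBelow_lt (by
        rw [hκ.cof_ord]; exact (Cardinal.lt_ord.1 hyp.1).trans hτκ) hyp.2
      obtain ⟨c, hc, hcB⟩ := hgrow _ hsup
      have hex : ∀ α, ∃ σ < κ.ord, (∃ σ < κ.ord, Good p j α σ) → Good p j α σ := by
        intro α
        by_cases hα : ∃ σ < κ.ord, Good p j α σ
        · obtain ⟨σ, hσ, hg⟩ := hα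
          exact ⟨σ, hσ, fun _ => hg⟩
        · exact ⟨0, hκ.ord_pos, fun h => absurd h hα⟩
      choose s hs hsg using hex
      obtain ⟨t, ht, hst⟩ := exists_lt_forall_le (f := s) (c := τ.ord) (o := κ.ord)
        (by rwa [card_ord, hκ.cof_ord]) fun α _ => hs α
      have hlim := isSuccLimit_ord hκ.aleph0_le
      have hb : max (supBelow p j + 1) (max c t) < κ.ord :=
        max_lt (hlim.succ_lt hsup) (max_lt hc ht)
      refine ⟨max (supBelow p j + 1) (max c t), fun _ _ => ⟨hb,
        (Order.lt_succ _).trans_le (le_max_left _ _), fun hmem => hcB ?_, fun α hα hσ => ?_⟩⟩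
      · exact sdiff_trans (hBmono _ hb c ((le_max_left _ _).trans (le_max_right _ _))) hmem
      · exact good_mono ((hst α hα).trans ((le_max_right _ _).trans (le_max_right _ _))) hb
          (hsg α hσ))
  have hpκ : ∀ j, j < τ.ord → p j < κ.ord := by
    intro j
    induction j using WellFoundedLT.induction with
    | _ j ih => exact fun hj => (hp j hj fun k hk => ih k hk (hk.trans hj)).1
  have hp' := fun j (hj : j < τ.ord) => hp j hj fun k hk => hpκ k (hk.trans hj)
  have hcl : Climbs p τ.ord := fun j hj => (hp' j hj).2.1
  have hδ : supBelow p τ.ord < κ.ord := supBelow_lt (by rwa [card_ord, hκ.cof_ord]) hpκ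
  obtain ⟨hclQ, hsupQ, hQf⟩ := hQ _ hδ ⟨p, hcl, rfl⟩
  obtain ⟨α, hα, hmem, hmono, hnomax⟩ := he _ (hcl.isClubBelow_eq hτ hτ' hclQ hsupQ.symm)
  -- the bounds along `e α` are possible, as `f δ` is one
  have hgood : ∀ j < τ.ord, Good p j α (p j) := by
    intro j hj
    refine (hp' j hj).2.2.2 α hα ⟨supBelow p τ.ord, hδ, (J A I κ).lower ?_ hsmall⟩
    rintro a ⟨ε, hε, -, ha⟩
    by_contra hnot
    rw [(hmem ε hε).2] at ha
    exact (hQf a (not_le.1 hnot) _ (hmem ε hε).1).not_gt ha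
  let B : Ordinal.{u + 1} → Set A := fun i => exceed (f i) h
  let W : Ordinal.{u + 1} → Set A := fun ε => {a | ∃ ζ ≤ ε, a ∈ B (supBelow p (e α ζ))}
  obtain ⟨ε₀, hε₀, hst⟩ := hsat.exists_stable hθ W (by
    rintro ε - ζ hζ a ⟨ξ, hξ, ha⟩
    exact ⟨ξ, hξ.trans hζ, ha⟩)
  have hle : ∀ i j, i < j → j < τ.ord → B (p i) \ B (supBelow p j) ∈ J A I κ := fun i j hij hj =>
    hBmono _ ((supBelow_mono p hj.le).trans_lt hδ) _ (le_supBelow p hij)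
  obtain ⟨ε₁, hε₁, h₀₁⟩ := hnomax ε₀ hε₀
  obtain ⟨ε₂, hε₂, h₁₂⟩ := hnomax ε₁ hε₁
  have he₀ := (hmem ε₀ hε₀).1
  have he₁ := (hmem ε₁ hε₁).1
  have he₂ := (hmem ε₂ hε₂).1
  refine (hp' _ he₁).2.2.1 ?_
  have s₁ : B (supBelow p (e α ε₂)) \ W ε₀ ∈ J A I κ :=
    (J A I κ).lower (by
      rintro a ⟨ha, hna⟩
      exact ⟨⟨ε₂, le_rfl, ha⟩, hna⟩)
      (mem_J_of_mem (hst ε₂ hε₂))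
  have s₂ : W ε₀ \ B (p (e α ε₀)) ∈ J A I κ := by
    refine (J A I κ).lower ?_ (hgood _ he₀)
    rintro a ⟨⟨ζ, hζ, ha⟩, hna⟩
    exact ⟨ζ, hζ.trans_lt hε₀, hmono hζ, (exceed_subset_union _ _ _ ha).resolve_right hna⟩
  exact sdiff_trans (hle _ _ h₁₂ he₂) (sdiff_trans s₁ (sdiff_trans s₂ (hle _ _ h₀₁ he₁)))

end Pcf

theorem mainTheorem4 (A : Set Cardinal.{u}) (hA : ∀ a ∈ A, a.IsRegular)
    (hmax : ¬ ∃ m, IsGreatest A m) (I : Order.Ideal (Set A)) (hI : Pcf.Progressive A I)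
    (κ : Cardinal.{u + 1}) (hκ : κ ∈ Pcf.pcf A I) :
    ∃ B : Set A, Pcf.IsGenerator A I κ B := by
  obtain ⟨hθ, hsat, -⟩ := Pcf.regularAt_reg I
  rcases le_or_gt κ (Order.succ (Order.succ (Pcf.reg I))) with hle | hlt
  · exact ⟨_, Pcf.isGenerator_of_le_succ_succ hA hI.2 hle⟩
  · obtain ⟨D, -, rfl⟩ := hκ
    refine Pcf.exists_isGenerator_of_lt hA hθ hsat hI.2 (Pcf.isRegular_ultracof hA D ?_) hlt
    exact hθ.aleph0_le.trans ((Order.le_succ _).trans ((Order.le_succ _).trans hlt.le))
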